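/- Let $\mathcal H$ be the upper half plane. A modular function is a holomorphic function $f:\mathcal H\to\mathbb C$ that is invariant under $\mathrm{SL}(2,\mathbb Z)$ and meromorphic at the cusp $i\infty$. **Cycle integrals.** Let $w$ be a real quadratic irrationality, let $Q_w=[a,b,c]$ be the unique primitive integral binary quadratic form with $w=\frac{-b+\sqrt D}{2a}$, where $D=b^2-4ac>0$, and let $\tilde w=\frac{-b-\sqrt D}{2a}$. Let $(t,u)$ be the smallest positive integer solution of $t^2-Du^2=4$ and put $\varepsilon=\frac{t+u\sqrt D}{2}$. Let $S_w$ be the geodesic in $\mathcal H$ from $w$ to $\tilde w$, let $\Gamma_w$ be the stabilizer of $w$ in $\mathrm{PSL}(2,\mathbb Z)$, and let $C_w=S_w/\Gamma_w$, which is a closed geodesic of length $2\log\varepsilon$. For a modular function $f$ put $$f(w)=\int_{C_w}\frac{\sqrt D\,f(z)}{Q_w(z,1)}\,dz,\qquad f^{nor}(w)=\frac{f(w)}{2\log\varepsilon}.$$ **The Markov tree.** Write $[\overline{s_0,\dots,s_n}]$ for the real number with this purely periodic continued fraction expansion $s_0+\cfrac{1}{s_1+\cdots}$, and let $\odot$ be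 the concatenation of periods, $[\overline{s_0,\dots,s_n}]\odot[\overline{t_0,\dots,t_m}]=[\overline{s_0,\dots,s_n,t_0,\dots,t_m}]$. The Markov tree is the infinite binary tree in which every vertex has a left predecessor $x$ and a right predecessor $y$ and carries the Markov quadratic $y\odot x$. The top vertex has left predecessor $[\overline{1,1}]$ and right predecessor $[\overline{2,2}]$, hence carries $[\overline{2,2,1,1}]$. A vertex that carries $v$ and has predecessors $x$ (left) and $y$ (right) has a left child with predecessors $x$ (left) and $v$ (right), and a right child with predecessors $v$ (left) and $y$ (right). A left (right) branch $B$ is an infinite path going downwards whose every step leads to the left (right) child and which is maximal upwards; its first vertex is its tip. For $n\ge 1$ let $w_n^B$ be the Markov quadratic at the $n$-th vertex of $B$ (so $w_1^B$ is at the tip), and let $w_0^B$ be the left (right) predecessor of the tip if $B$ is a left (right) branch. **Theorem.** Let $f$ be a modular function. For every branch $B$ of the Markov tree, $$\lim_{n\to\infty} f^{nor}(w_n^B)=f^{nor}(w_0^B).$$ -/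

import Mathlib

open scoped UpperHalfPlane MatrixGroups Manifold Topology

noncomputable section

namespace MarkovCycle

/-! ### Modular functions -/

/-- A modular function for `SL(2, ℤ)`: a holomorphic function on the upper half plane that is
invariant under the modular group and meromorphic at the cusp `i∞`, that is, meromorphic at `q = 0`
as a function of `q = exp (2 π i z)`. -/
structure IsModularFunction (f : ℍ → ℂ) : Prop where
  holo : MDifferentiable 𝓘(ℂ) 𝓘(ℂ) f
  invariant : ∀ (g : SL(2, ℤ)) (z : ℍ), f (g • z) = f z
  merom_cusp : MeromorphicAt (Function.Periodic.cuspFunction 1 (f ∘ UpperHalfPlane.ofComplex)) 0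

/-! ### Real quadratic irrationalities and cycle integrals -/

/-- An integral binary quadratic form `[a, b, c]`. -/
@[ext] structure QForm where
  a : ℤ
  b : ℤ
  c : ℤ

instance : Inhabited QForm := ⟨⟨0, 0, 0⟩⟩

/-- The discriminant `D = b² - 4ac`. -/
def QForm.disc (Q : QForm) : ℤ := Q.b ^ 2 - 4 * Q.a * Q.c

/-- The value `Q(z, 1) = a z² + b z + c`. -/
def QForm.eval (Q : QForm) (z : ℂ) : ℂ := Q.a * z ^ 2 + Q.b * z + Q.c

/-- The first root `(-b + √D) / (2a)`. -/
def QForm.root (Q : QForm) : ℝ := (-Q.b + √(Q.disc : ℝ)) / (2 * Q.a)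

/-- The second root `(-b - √D) / (2a)`. -/
def QForm.conjRoot (Q : QForm) : ℝ := (-Q.b - √(Q.disc : ℝ)) / (2 * Q.a)

/-- `Q` is the primitive integral form, of positive discriminant, whose first root is `w`. For a
real quadratic irrationality `w` there is exactly one such form. -/
def QForm.IsFormOf (Q : QForm) (w : ℝ) : Prop :=
  Q.a ≠ 0 ∧ Int.gcd Q.a (Int.gcd Q.b Q.c) = 1 ∧ 0 < Q.disc ∧ w = Q.root

/-- The form `Q_w` of a real quadratic irrationality `w` (junk for other real numbers). -/
def quadForm (w : ℝ) : QForm := Classical.epsilon fun Q : QForm => Q.IsFormOf w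

/-- The `t` of the smallest positive solution `(t, u)` of `t² - D u² = 4`. -/
def pellT (D : ℤ) : ℕ := sInf {t : ℕ | 0 < t ∧ ∃ u : ℕ, 0 < u ∧ (t : ℤ) ^ 2 - D * (u : ℤ) ^ 2 = 4}

/-- The `u` of the smallest positive solution `(t, u)` of `t² - D u² = 4`. -/
def pellU (D : ℤ) : ℕ := sInf {u : ℕ | 0 < u ∧ ∃ t : ℕ, 0 < t ∧ (t : ℤ) ^ 2 - D * (u : ℤ) ^ 2 = 4}

/-- The unit `ε = (t + u √D) / 2`. -/
def fundUnit (D : ℤ) : ℝ := (pellT D + pellU D * √(D : ℝ)) / 2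

/-- The geodesic `S_w` of the upper half plane from `w` (at `s = -∞`) to `w'` (at `s = +∞`),
parametrized by hyperbolic arc length. -/
def geodesic (w w' : ℝ) (s : ℝ) : ℂ :=
  (((w + w') / 2 - (w - w') / 2 * Real.tanh s : ℝ) : ℂ) +
    ((|w - w'| / 2 / Real.cosh s : ℝ) : ℂ) * Complex.I

/-- The cycle integral `f(w) = ∫_{C_w} √D f(z) / Q_w(z, 1) dz` over the closed geodesic
`C_w = S_w / Γ_w`. The generator `A_w` of `Γ_w`, with entries `(t - bu) / 2`, `-cu`, `au`,
`(t + bu) / 2`, acts on `S_w` as the translation of length `2 log ε` towards `w`, so the arc of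
`S_w` over `0 ≤ s ≤ 2 log ε`, which runs from a point `z₀` to `A_w⁻¹ z₀`, represents `C_w`. -/
def cycleIntegral (f : ℍ → ℂ) (w : ℝ) : ℂ :=
  let Q := quadForm w
  let γ : ℝ → ℂ := geodesic Q.root Q.conjRoot
  ∫ s in (0 : ℝ)..(2 * Real.log (fundUnit Q.disc)),
    (√(Q.disc : ℝ) : ℂ) * f (UpperHalfPlane.ofComplex (γ s)) / Q.eval (γ s) * deriv γ s

/-- The normalized value `f(w) / (2 log ε)`. -/
def norValue (f : ℍ → ℂ) (w : ℝ) : ℂ :=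
  cycleIntegral f w / ((2 * Real.log (fundUnit (quadForm w).disc) : ℝ) : ℂ)

/-! ### Continued fractions -/

/-- The finite continued fraction `[a₀, a₁, …, aₙ] = a₀ + 1 / (a₁ + 1 / (… + 1 / aₙ))`. -/
def convergent (a : ℕ → ℕ) : ℕ → ℝ
  | 0 => a 0
  | n + 1 => a 0 + 1 / convergent (fun i => a (i + 1)) n

/-- The infinite continued fraction `[a₀, a₁, a₂, …]`, the limit of its convergents. -/
def contFrac (a : ℕ → ℕ) : ℝ := Filter.limUnder Filter.atTop (convergent a)

/-- The purely periodic continued fraction with period `s`. -/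
def periodicCF (s : List ℕ) : ℝ := contFrac fun i => s.getD (i % s.length) 0

/-! ### The Markov tree and its branches -/

/-- Left or right. -/
inductive Dir
  | left
  | right

/-- A vertex of the Markov tree, recorded by the continued fraction periods of its left and its
right predecessor. -/
structure Vertex where
  leftPred : List ℕ
  rightPred : List ℕ

/-- The period at a vertex: the conjunction of the periods of its right and its left
predecessor. -/
def Vertex.period (v : Vertex) : List ℕ := v.rightPred ++ v.leftPred

/-- The period of the left or of the right predecessor. -/
def Vertex.pred (v : Vertex) : Dir → List ℕ
  | Dir.left => v.leftPred
  | Dir.right => v.rightPred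

/-- The two children of a vertex. The left child lies between the left predecessor of the vertex
and the vertex itself, the right child between the vertex and its right predecessor. -/
def Vertex.child (v : Vertex) : Dir → Vertex
  | Dir.left => ⟨v.leftPred, v.period⟩
  | Dir.right => ⟨v.period, v.rightPred⟩

/-- The top vertex, with period `2, 2, 1, 1`, whose predecessors are the two singular vertices
with periods `1, 1` (left) and `2, 2` (right). -/
def topVertex : Vertex := ⟨[1, 1], [2, 2]⟩

/-- The vertex of the Markov tree reached from the top vertex by the given moves, the first move
first. -/
def vertexAt (p : List Dir) : Vertex := p.foldl Vertex.child topVertex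

/-- A branch of the Markov tree: an infinite descending path that always moves in the same
direction `dir`. It starts at its tip, given by the moves from the top vertex to it. The branch
cannot be prolonged upwards: the tip is the top vertex, or the last move to it is not `dir`. -/
structure Branch where
  dir : Dir
  tip : List Dir
  maximal : tip.getLast? ≠ some dir

/-- The Markov quadratics along a branch. For `n ≥ 1` this is the quadratic at the `n`-th vertex
of the branch, the first one being the tip; for `n = 0` it is the left (right) predecessor of the
tip if the branch is a left (right) branch. -/
def Branch.quadratic (B : Branch) : ℕ → ℝ
  | 0 => periodicCF ((vertexAt B.tip).pred B.dir)
  | n + 1 => periodicCF (vertexAt (B.tip ++ List.replicate n B.dir)).period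

end MarkovCycle

end

noncomputable section

namespace MarkovCycle

open Filter Matrix

/-! ### Geodesics and their equivariance -/

/-! A purely periodic continued fraction with an even period is the positive fixed point of a matrix
in `SL(2, ℤ)` with positive entries (`IsWord.periodicCF_eq`), and concatenation of periods is
multiplication of matrices. Along a branch the matrices are `h * g ^ n` (left) or `h ^ n * g`
(right), where the repeated factor belongs to `w₀`. The closed geodesic of `w_n` therefore winds
about `n` times along that of `w₀`, apart from a bounded excursion.

On the geodesic, `√D dz / Q` is the arc length element (`integrand_eq`), so the normalized value is
the mean of `f` over a closed geodesic. It may be computed over any period of `f` along the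
geodesic, so the matrix at hand need not generate the stabilizer (`periodic_mean_eq`,
`norValue_fixPt`).

The integral is a cocycle in the matrix (`arcIntegral_mul`), hence the integral for `g * h ^ n` is
one term for `g` plus `n` terms for `h`. Positive matrices contract the positive half line
(`IsPos.contract`), so in all but a bounded number of these terms the endpoints are close to the
fixed points of `h`. A Cesàro argument gives `loopIntegral f (g * h ^ n) / n → loopIntegral f h`
(`tendsto_loopIntegral`). The same limit for the constant function 1 treats the lengths, and the
quotient is the theorem. -/

/-- The geodesic from `w` to `w'` for `w' < w`, in exponential form. -/
def geo (w w' s : ℝ) : ℂ :=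
  (w - Complex.I * (Real.exp s : ℝ) * w') / (1 - Complex.I * (Real.exp s : ℝ))

lemma one_sub_I_mul_ne_zero (x : ℝ) : (1 - Complex.I * x : ℂ) ≠ 0 := by
  intro h
  simpa using congrArg Complex.re h

lemma geo_eq (w w' s : ℝ) :
    geo w w' s = (((w + Real.exp s ^ 2 * w') / (1 + Real.exp s ^ 2) : ℝ) : ℂ) +
      ((Real.exp s * (w - w') / (1 + Real.exp s ^ 2) : ℝ) : ℂ) * Complex.I := by
  have h := one_sub_I_mul_ne_zero (Real.exp s)
  have h2 : (1 + (Real.exp s : ℂ) ^ 2) ≠ 0 := by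
    have : (1 + Real.exp s ^ 2 : ℝ) ≠ 0 := by positivity
    exact_mod_cast this
  rw [geo, div_eq_iff h]
  push_cast at *
  field_simp
  ring_nf
  rw [Complex.I_sq]
  ring

lemma geo_im (w w' s : ℝ) : (geo w w' s).im = Real.exp s * (w - w') / (1 + Real.exp s ^ 2) := by
  rw [geo_eq]; simp [-Complex.ofReal_exp, -Complex.ofReal_div, -Complex.ofReal_mul,
    -Complex.ofReal_add, -Complex.ofReal_pow, -Complex.ofReal_sub]

lemma geo_im_pos {w w' : ℝ} (h : w' < w) (s : ℝ) : 0 < (geo w w' s).im := by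
  rw [geo_im]
  have := sub_pos.2 h
  positivity

lemma geodesic_eq_geo {w w' : ℝ} (h : w' < w) (s : ℝ) : geodesic w w' s = geo w w' s := by
  have hE := Real.exp_pos s
  rw [geo_eq, geodesic, Real.tanh_eq_sinh_div_cosh, Real.sinh_eq, Real.cosh_eq, Real.exp_neg,
    abs_of_pos (sub_pos.2 h)]
  congr 2
  · norm_cast
    field_simp
    ring
  · norm_cast
    field_simp
    ring

lemma continuous_geo {X : Type*} [TopologicalSpace X] {w w' s : X → ℝ} (hw : Continuous w)
    (hw' : Continuous w') (hs : Continuous s) : Continuous fun x => geo (w x) (w' x) (s x) := by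
  unfold geo
  refine Continuous.div (by fun_prop) (by fun_prop) fun x => one_sub_I_mul_ne_zero _

/-- The values of `f` along the geodesic from `w` to `w'`. -/
def alongGeo (f : ℍ → ℂ) (w w' s : ℝ) : ℂ := f (UpperHalfPlane.ofComplex (geo w w' s))

lemma continuous_alongGeo {X : Type*} [TopologicalSpace X] {f : ℍ → ℂ} (hf : Continuous f)
    {w w' s : X → ℝ} (hw : Continuous w) (hw' : Continuous w') (hs : Continuous s)
    (h : ∀ x, w' x < w x) : Continuous fun x => alongGeo f (w x) (w' x) (s x) := by
  have h1 : Continuous fun x => (⟨geo (w x) (w' x) (s x), geo_im_pos (h x) _⟩ : ℍ) :=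
    UpperHalfPlane.isEmbedding_coe.continuous_iff.2 (continuous_geo hw hw' hs)
  refine (hf.comp h1).congr fun x => ?_
  rw [Function.comp_apply, alongGeo, UpperHalfPlane.ofComplex_apply_of_im_pos (geo_im_pos (h x) _)]

/-- The real Möbius action of an integral matrix. -/
def mob (A : Matrix (Fin 2) (Fin 2) ℤ) (v : ℝ) : ℝ := (A 0 0 * v + A 0 1) / (A 1 0 * v + A 1 1)

lemma det_real (g : SL(2, ℤ)) : (g 0 0 * g 1 1 - g 0 1 * g 1 0 : ℝ) = 1 := by
  have := g.det_coe
  rw [Matrix.det_fin_two] at this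
  exact_mod_cast this

lemma mob_sub_mob (g : SL(2, ℤ)) {v w : ℝ} (hv : (g 1 0 * v + g 1 1 : ℝ) ≠ 0)
    (hw : (g 1 0 * w + g 1 1 : ℝ) ≠ 0) :
    mob g v - mob g w = (v - w) / ((g 1 0 * v + g 1 1) * (g 1 0 * w + g 1 1)) := by
  have := det_real g
  rw [mob, mob, div_sub_div _ _ hv hw]
  congr 1
  linear_combination (v - w) * this

/-- Applying `g` to `(w - iE w') / (1 - iE)` and extracting the denominators of `g` at `w` and `w'`
gives the same expression for the image endpoints, with `E = exp s` multiplied by the ratio of the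
two denominators. So `g` carries geodesic to geodesic with a shift of the arc length parameter. -/
lemma alongGeo_smul {f : ℍ → ℂ} (hi : ∀ (g : SL(2, ℤ)) (z : ℍ), f (g • z) = f z) (g : SL(2, ℤ))
    {w w' : ℝ} (h : w' < w) (hw : (0 : ℝ) < g 1 0 * w + g 1 1)
    (hw' : (0 : ℝ) < g 1 0 * w' + g 1 1) (s : ℝ) :
    alongGeo f w w' s = alongGeo f (mob g w) (mob g w')
      (s - Real.log ((g 1 0 * w + g 1 1) / (g 1 0 * w' + g 1 1))) := by
  have hlt : mob g w' < mob g w := by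
    rw [← sub_pos, mob_sub_mob g hw.ne' hw'.ne']
    have := sub_pos.2 h
    positivity
  rw [alongGeo, alongGeo, UpperHalfPlane.ofComplex_apply_of_im_pos (geo_im_pos h _),
    UpperHalfPlane.ofComplex_apply_of_im_pos (geo_im_pos hlt _), ← hi g]
  congr 1
  apply UpperHalfPlane.ext
  rw [UpperHalfPlane.coe_specialLinearGroup_apply]
  have h1 := one_sub_I_mul_ne_zero (Real.exp s)
  have e : Real.exp (s - Real.log ((g 1 0 * w + g 1 1) / (g 1 0 * w' + g 1 1))) =
      Real.exp s * (g 1 0 * w' + g 1 1) / (g 1 0 * w + g 1 1) := by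
    rw [Real.exp_sub, Real.exp_log (by positivity)]
    field_simp
  have h2 := one_sub_I_mul_ne_zero
    (Real.exp s * (g 1 0 * w' + g 1 1) / (g 1 0 * w + g 1 1))
  simp only [geo, e, mob]
  generalize Real.exp s = E at *
  have h3 : ((g 1 0 : ℂ) * w + g 1 1) ≠ 0 := by exact_mod_cast hw.ne'
  have h4 : ((g 1 0 : ℂ) * w' + g 1 1) ≠ 0 := by exact_mod_cast hw'.ne'
  simp only [algebraMap_int_eq, eq_intCast]
  have h5 : (1 - Complex.I * E : ℂ) * ((g 1 0 : ℂ) * ((w - Complex.I * E * w') /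
      (1 - Complex.I * E)) + g 1 1) = (g 1 0 * w + g 1 1) *
      (1 - Complex.I * (E * (g 1 0 * w' + g 1 1) / (g 1 0 * w + g 1 1) : ℝ)) := by
    push_cast
    field_simp
    ring
  have h6 : ((g 1 0 : ℂ) * ((w - Complex.I * E * w') / (1 - Complex.I * E)) + g 1 1) ≠ 0 := by
    intro h0
    rw [h0, mul_zero] at h5
    exact mul_ne_zero h3 h2 h5.symm
  have h7 : (1 - Complex.I * E : ℂ) * ((g 0 0 : ℂ) * ((w - Complex.I * E * w') /
      (1 - Complex.I * E)) + g 0 1) = (g 1 0 * w + g 1 1) *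
      (((g 0 0 * w + g 0 1) / (g 1 0 * w + g 1 1) : ℝ) - Complex.I *
        (E * (g 1 0 * w' + g 1 1) / (g 1 0 * w + g 1 1) : ℝ) *
        ((g 0 0 * w' + g 0 1) / (g 1 0 * w' + g 1 1) : ℝ)) := by
    push_cast
    generalize ((g 1 0 : ℂ) * w + g 1 1) = k at *
    generalize ((g 1 0 : ℂ) * w' + g 1 1) = k' at *
    field_simp
    ring
  push_cast at *
  rw [div_eq_div_iff h6 h2]
  apply mul_left_cancel₀ h1
  linear_combination
    (1 - Complex.I * (E * (g 1 0 * w' + g 1 1) / (g 1 0 * w + g 1 1))) * h7 -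
    ((g 0 0 * w + g 0 1) / (g 1 0 * w + g 1 1) - Complex.I *
        (E * (g 1 0 * w' + g 1 1) / (g 1 0 * w + g 1 1)) *
        ((g 0 0 * w' + g 0 1) / (g 1 0 * w' + g 1 1)) : ℂ) * h5

/-! ### Matrices with positive entries -/

/-- All four entries are positive. -/
def IsPos (g : SL(2, ℤ)) : Prop := ∀ i j, 0 < g i j

lemma IsPos.mul {g h : SL(2, ℤ)} (hg : IsPos g) (hh : IsPos h) : IsPos (g * h) := by
  intro i j
  change 0 < (g.1 * h.1) i j
  rw [Matrix.mul_apply, Fin.sum_univ_two]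
  have := mul_pos (hg i 0) (hh 0 j)
  have := mul_pos (hg i 1) (hh 1 j)
  lia

lemma IsPos.real {g : SL(2, ℤ)} (hg : IsPos g) (i j : Fin 2) : (1 : ℝ) ≤ g i j := by
  exact_mod_cast hg i j

/-- The anti-involution exchanging the diagonal entries. It describes the action of the inverse
on the negative half line. -/
def swapDiag (g : SL(2, ℤ)) : SL(2, ℤ) :=
  ⟨!![g 1 1, g 0 1; g 1 0, g 0 0], by
    have := g.det_coe
    rw [Matrix.det_fin_two] at this ⊢
    simp only [of_apply, cons_val', cons_val_zero, cons_val_one, cons_val_fin_one]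
    linarith⟩

@[simp] lemma swapDiag_00 (g : SL(2, ℤ)) : swapDiag g 0 0 = g 1 1 := rfl
@[simp] lemma swapDiag_01 (g : SL(2, ℤ)) : swapDiag g 0 1 = g 0 1 := rfl
@[simp] lemma swapDiag_10 (g : SL(2, ℤ)) : swapDiag g 1 0 = g 1 0 := rfl
@[simp] lemma swapDiag_11 (g : SL(2, ℤ)) : swapDiag g 1 1 = g 0 0 := rfl

lemma swapDiag_mul (g h : SL(2, ℤ)) : swapDiag (g * h) = swapDiag h * swapDiag g := by
  ext i j
  change (swapDiag (g * h)).1 i j = ((swapDiag h).1 * (swapDiag g).1) i j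
  rw [Matrix.mul_apply, Fin.sum_univ_two]
  fin_cases i <;> fin_cases j <;> simp [Matrix.mul_apply] <;> ring

lemma IsPos.flip {g : SL(2, ℤ)} (hg : IsPos g) : IsPos (swapDiag g) := by
  intro i j
  fin_cases i <;> fin_cases j <;> simp <;> apply hg

lemma IsPos.denom_ge {g : SL(2, ℤ)} (hg : IsPos g) {v : ℝ} (hv : 0 ≤ v) :
    1 ≤ (g 1 0 * v + g 1 1 : ℝ) := by
  have := hg.real 1 0
  have := hg.real 1 1
  nlinarith

lemma IsPos.denom_pos {g : SL(2, ℤ)} (hg : IsPos g) {v : ℝ} (hv : 0 ≤ v) :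
    0 < (g 1 0 * v + g 1 1 : ℝ) := zero_lt_one.trans_le (hg.denom_ge hv)

lemma IsPos.mob_pos {g : SL(2, ℤ)} (hg : IsPos g) {v : ℝ} (hv : 0 ≤ v) : 0 < mob g v := by
  have := hg.real 0 0
  have := hg.real 0 1
  have := hg.denom_pos hv
  unfold mob
  positivity

lemma IsPos.mob_le {g : SL(2, ℤ)} (hg : IsPos g) {v : ℝ} (hv : 0 ≤ v) :
    mob g v ≤ g 0 0 + g 0 1 := by
  have := hg.real 0 0
  have := hg.real 0 1
  have := hg.real 1 0
  have := hg.real 1 1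
  rw [mob, div_le_iff₀ (hg.denom_pos hv)]
  have h1 : (g 0 0 : ℝ) * v ≤ (g 0 0 + g 0 1) * (g 1 0 * v) := by
    apply mul_le_mul <;> nlinarith
  nlinarith

lemma mob_mul (A B : Matrix (Fin 2) (Fin 2) ℤ) {v : ℝ} (hv : (B 1 0 * v + B 1 1 : ℝ) ≠ 0) :
    mob (A * B) v = mob A (mob B v) := by
  simp only [mob, Matrix.mul_apply, Fin.sum_univ_two]
  have key (p q x y : ℝ) (hy : y ≠ 0) : p * (x / y) + q = (p * x + q * y) / y := by field_simp
  rw [key _ _ _ _ hv, key _ _ _ _ hv, div_div_div_cancel_right₀ hv]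
  push_cast
  congr 1 <;> ring

lemma mob_mul_pos {g h : SL(2, ℤ)} (hh : IsPos h) {v : ℝ} (hv : 0 ≤ v) :
    mob (g * h : SL(2, ℤ)) v = mob g (mob h v) := by
  exact mob_mul g.1 h.1 (hh.denom_pos hv).ne'

lemma IsPos.trace_ge {g : SL(2, ℤ)} (hg : IsPos g) : 3 ≤ g 0 0 + g 1 1 := by
  have := hg 0 0
  have := hg 0 1
  have := hg 1 0
  have := hg 1 1
  have := g.det_coe
  rw [Matrix.det_fin_two] at this
  nlinarith

/-- The positive root of the discriminant of the fixed point equation. -/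
def rootDisc (g : SL(2, ℤ)) : ℝ := √((g 0 0 + g 1 1) ^ 2 - 4)

/-- The positive fixed point of a matrix with positive entries. -/
def fixPt (g : SL(2, ℤ)) : ℝ := (g 0 0 - g 1 1 + rootDisc g) / (2 * g 1 0)

lemma IsPos.trace_real {g : SL(2, ℤ)} (hg : IsPos g) : (3 : ℝ) ≤ g 0 0 + g 1 1 := by
  exact_mod_cast hg.trace_ge

lemma IsPos.rootDisc_sq {g : SL(2, ℤ)} (hg : IsPos g) :
    rootDisc g ^ 2 = (g 0 0 + g 1 1) ^ 2 - 4 := by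
  have := hg.trace_real
  exact Real.sq_sqrt (by nlinarith)

lemma IsPos.rootDisc_pos {g : SL(2, ℤ)} (hg : IsPos g) : 0 < rootDisc g := by
  have := hg.trace_real
  exact Real.sqrt_pos.2 (by nlinarith)

lemma rootDisc_swapDiag (g : SL(2, ℤ)) : rootDisc (swapDiag g) = rootDisc g := by
  simp [rootDisc, add_comm]

lemma IsPos.fixPt_pos {g : SL(2, ℤ)} (hg : IsPos g) : 0 < fixPt g := by
  have h1 := hg.rootDisc_sq
  have := hg.rootDisc_pos
  have := hg.real 1 0
  have := hg.real 0 1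
  have := det_real g
  refine div_pos ?_ (by positivity)
  by_contra hc
  have h2 : rootDisc g ≤ g 1 1 - g 0 0 := by linarith
  nlinarith

lemma IsPos.fixPt_eq {g : SL(2, ℤ)} (hg : IsPos g) :
    g 1 0 * fixPt g ^ 2 + (g 1 1 - g 0 0) * fixPt g - g 0 1 = 0 := by
  have h1 := hg.rootDisc_sq
  have := hg.real 1 0
  have h2 := det_real g
  have h3 : (g 1 0 : ℝ) ≠ 0 := by positivity
  unfold fixPt
  field_simp
  linear_combination h1 + 4 * h2

lemma IsPos.mob_fixPt {g : SL(2, ℤ)} (hg : IsPos g) : mob g (fixPt g) = fixPt g := by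
  rw [mob, div_eq_iff (hg.denom_pos hg.fixPt_pos.le).ne']
  linear_combination -hg.fixPt_eq

lemma IsPos.denom_fixPt {g : SL(2, ℤ)} (hg : IsPos g) :
    g 1 0 * fixPt g + g 1 1 = (g 0 0 + g 1 1 + rootDisc g) / 2 := by
  have := hg.real 1 0
  have h3 : (g 1 0 : ℝ) ≠ 0 := by positivity
  unfold fixPt
  field_simp
  ring

lemma IsPos.denom_fixPt_gt {g : SL(2, ℤ)} (hg : IsPos g) :
    1 < g 1 0 * fixPt g + g 1 1 := by
  rw [hg.denom_fixPt]
  have := hg.trace_real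
  have := hg.rootDisc_pos
  linarith

/-- In `mob_sub_mob` the denominator at `v` is at least 1, and the one at the fixed point is the
larger eigenvalue of `g`, which exceeds 1. -/
lemma IsPos.contract {g : SL(2, ℤ)} (hg : IsPos g) {v : ℝ} (hv : 0 ≤ v) :
    |mob g v - fixPt g| ≤ |v - fixPt g| * (g 1 0 * fixPt g + g 1 1)⁻¹ := by
  have h1 := hg.denom_ge hv
  have h2 := hg.denom_fixPt_gt
  have h : mob g v - fixPt g = mob g v - mob g (fixPt g) := by rw [hg.mob_fixPt]
  rw [h, mob_sub_mob g (hg.denom_pos hv).ne' (by linarith), abs_div, ← div_eq_mul_inv]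
  refine div_le_div_of_nonneg_left (abs_nonneg _) (by linarith) ?_
  rw [abs_of_pos (by positivity)]
  nlinarith

lemma IsPos.eq_fixPt {g : SL(2, ℤ)} (hg : IsPos g) {v : ℝ} (hv : 0 ≤ v) (h : mob g v = v) :
    v = fixPt g := by
  have h1 := hg.contract hv
  have h2 : (g 1 0 * fixPt g + g 1 1)⁻¹ < 1 := inv_lt_one_of_one_lt₀ hg.denom_fixPt_gt
  rw [h] at h1
  by_contra hne
  have := abs_pos.2 (sub_ne_zero.2 hne)
  nlinarith

lemma IsPos.fixPt_mul_comm {g h : SL(2, ℤ)} (hg : IsPos g) (hh : IsPos h) :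
    mob h (fixPt (g * h)) = fixPt (h * g) := by
  have h0 := (hg.mul hh).fixPt_pos.le
  have h1 := (hh.mob_pos h0).le
  apply (hh.mul hg).eq_fixPt h1
  rw [mob_mul_pos hg h1, ← mob_mul_pos hh h0, (hg.mul hh).mob_fixPt]

lemma IsPos.iterate_nonneg {g : SL(2, ℤ)} (hg : IsPos g) {v : ℝ} (hv : 0 ≤ v) (n : ℕ) :
    0 ≤ (mob g)^[n] v := by
  induction n with
  | zero => exact hv
  | succ n ih => rw [Function.iterate_succ_apply']; exact (hg.mob_pos ih).le

lemma IsPos.iterate_contract {g : SL(2, ℤ)} (hg : IsPos g) {v : ℝ} (hv : 0 ≤ v) (n : ℕ) :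
    |(mob g)^[n] v - fixPt g| ≤ |v - fixPt g| * (g 1 0 * fixPt g + g 1 1)⁻¹ ^ n := by
  induction n with
  | zero => simp
  | succ n ih =>
    rw [Function.iterate_succ_apply', pow_succ, ← mul_assoc]
    have h2 := hg.denom_fixPt_gt
    exact (hg.contract (hg.iterate_nonneg hv n)).trans (by gcongr)

/-! ### The integral cocycle -/

/-- The denominator of the Möbius action. -/
def den (A : Matrix (Fin 2) (Fin 2) ℤ) (v : ℝ) : ℝ := A 1 0 * v + A 1 1

lemma IsPos.den_pos {g : SL(2, ℤ)} (hg : IsPos g) {v : ℝ} (hv : 0 ≤ v) : 0 < den g v :=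
  hg.denom_pos hv

lemma den_mul {g h : SL(2, ℤ)} (hh : IsPos h) {v : ℝ} (hv : 0 ≤ v) :
    den (g * h : SL(2, ℤ)) v = den g (mob h v) * den h v := by
  change den (g.1 * h.1) v = _
  have key (p q x y : ℝ) (hy : y ≠ 0) : (p * (x / y) + q) * y = p * x + q * y := by field_simp
  simp only [den, mob, Matrix.mul_apply, Fin.sum_univ_two]
  rw [key _ _ _ _ (hh.denom_pos hv).ne']
  push_cast
  ring

/-- The displacement of `g` along the geodesic from `v` to `g⁻¹ (-q)`. -/
def displacement (g : SL(2, ℤ)) (v q : ℝ) : ℝ := Real.log (den g v * den (swapDiag g) q)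

/-- The integral of `f` along the arc, of length `displacement g v q`, of the geodesic from `g v`
to `-q`. -/
def arcIntegral (f : ℍ → ℂ) (g : SL(2, ℤ)) (v q : ℝ) : ℂ :=
  ∫ s in (-displacement g v q)..0, alongGeo f (mob g v) (-q) s

lemma displacement_mul {g h : SL(2, ℤ)} (hg : IsPos g) (hh : IsPos h) {v q : ℝ} (hv : 0 ≤ v)
    (hq : 0 ≤ q) : displacement (g * h) v q =
      displacement g (mob h v) q + displacement h v (mob (swapDiag g) q) := by
  have h1 := hg.den_pos (hh.mob_pos hv).le
  have h2 := hh.den_pos hv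
  have h3 := hh.flip.den_pos (hg.flip.mob_pos hq).le
  have h4 := hg.flip.den_pos hq
  rw [displacement, displacement, displacement, swapDiag_mul, den_mul hh hv, den_mul hg.flip hq,
    ← Real.log_mul (by positivity) (by positivity)]
  congr 1
  ring

/-- Since `g⁻¹ (-q) = -(swapDiag g) q`, the second endpoint stays negative when pulled back by `g`.
The denominator of `g` there is the inverse of `den (swapDiag g) q`, which is why `displacement` is
the logarithm of a product. -/
lemma alongGeo_mob {f : ℍ → ℂ} (hi : ∀ (g : SL(2, ℤ)) (z : ℍ), f (g • z) = f z) {g : SL(2, ℤ)}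
    (hg : IsPos g) {v q : ℝ} (hv : 0 ≤ v) (hq : 0 ≤ q) (s : ℝ) :
    alongGeo f v (-mob (swapDiag g) q) s =
      alongGeo f (mob g v) (-q) (s - displacement g v q) := by
  have h0 := hg.flip.mob_pos hq
  have h1 := hg.flip.denom_pos hq
  have hd := det_real g
  have h2 : (g 1 0 * (-mob (swapDiag g) q) + g 1 1 : ℝ) = (den (swapDiag g) q)⁻¹ := by
    simp only [den, mob, swapDiag_00, swapDiag_01, swapDiag_10, swapDiag_11] at *
    field_simp
    linear_combination hd
  have h3 : mob g (-mob (swapDiag g) q) = -q := by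
    have key (a b x y : ℝ) (hy : y ≠ 0) : (a * -(x / y) + b) * y = -a * x + b * y := by
      field_simp
    rw [mob, h2, div_inv_eq_mul, mob, den, key _ _ _ _ h1.ne']
    simp only [swapDiag_00, swapDiag_01, swapDiag_10, swapDiag_11]
    linear_combination -q * hd
  have h4 : 0 < den (swapDiag g) q := h1
  rw [alongGeo_smul hi g (by linarith) (hg.denom_pos hv) (by rw [h2]; positivity), h3, h2,
    div_inv_eq_mul]
  rfl

lemma continuous_alongGeo_right {f : ℍ → ℂ} (hf : Continuous f) {w w' : ℝ} (h : w' < w) :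
    Continuous (alongGeo f w w') :=
  continuous_alongGeo hf continuous_const continuous_const continuous_id fun _ => h

/-- The arc for `g * h` is cut at distance `displacement g` from its end at parameter 0. The far
piece, pulled back by `g`, is the arc for `h` with the endpoints moved accordingly. -/
lemma arcIntegral_mul {f : ℍ → ℂ} (hf : Continuous f)
    (hi : ∀ (g : SL(2, ℤ)) (z : ℍ), f (g • z) = f z) {g h : SL(2, ℤ)} (hg : IsPos g)
    (hh : IsPos h) {v q : ℝ} (hv : 0 ≤ v) (hq : 0 ≤ q) :
    arcIntegral f (g * h) v q = arcIntegral f g (mob h v) q +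
      arcIntegral f h v (mob (swapDiag g) q) := by
  have h1 := (hh.mob_pos hv).le
  have h2 := hg.mob_pos h1
  have hc := continuous_alongGeo_right hf (show -q < mob g (mob h v) by linarith)
  simp only [arcIntegral, alongGeo_mob hi hg h1 hq]
  rw [mob_mul_pos hh hv, displacement_mul hg hh hv hq,
    intervalIntegral.integral_comp_sub_right (fun s => alongGeo f (mob g (mob h v)) (-q) s),
    zero_sub]
  refine Eq.trans ?_ ((intervalIntegral.integral_add_adjacent_intervals
    (hc.intervalIntegrable _ _) (hc.intervalIntegrable _ _)).symm.trans (add_comm _ _))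
  congr 1
  ring

lemma continuousOn_arcIntegral {f : ℍ → ℂ} (hf : Continuous f) {g : SL(2, ℤ)} (hg : IsPos g) :
    ContinuousOn (fun p : ℝ × ℝ => arcIntegral f g p.1 p.2) {p | 0 ≤ p.1 ∧ 0 ≤ p.2} := by
  -- Absolute values extend the integrand from the quadrant to a continuous function on the whole
  -- plane.
  have hd : Continuous fun p : ℝ × ℝ => displacement g |p.1| |p.2| := by
    unfold displacement
    refine Continuous.log (by unfold den; fun_prop) fun p => ?_
    exact (mul_pos (hg.den_pos (abs_nonneg _)) (hg.flip.den_pos (abs_nonneg _))).ne'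
  have hm : Continuous fun p : (ℝ × ℝ) × ℝ => mob g |p.1.1| := by
    unfold mob
    exact Continuous.div (by fun_prop) (by fun_prop) fun p => (hg.denom_pos (abs_nonneg _)).ne'
  have hu : Continuous (Function.uncurry fun (p : ℝ × ℝ) (s : ℝ) =>
      alongGeo f (mob g |p.1|) (-|p.2|) s) := by
    refine continuous_alongGeo hf hm (by fun_prop) continuous_snd fun p => ?_
    have := hg.mob_pos (abs_nonneg p.1.1)
    have := abs_nonneg p.1.2
    linarith
  have hc : Continuous fun p : ℝ × ℝ => arcIntegral f g |p.1| |p.2| := by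
    simp only [arcIntegral]
    simp_rw [intervalIntegral.integral_symm 0]
    exact (intervalIntegral.continuous_parametric_intervalIntegral_of_continuous hu hd.neg).neg
  refine hc.continuousOn.congr fun p hp => ?_
  dsimp only
  rw [abs_of_nonneg hp.1, abs_of_nonneg hp.2]

/-! ### Means along closed geodesics -/

/-- The integral of `f` along the closed geodesic of `g`. -/
def loopIntegral (f : ℍ → ℂ) (g : SL(2, ℤ)) : ℂ := arcIntegral f g (fixPt g) (fixPt (swapDiag g))

lemma loopIntegral_mul_comm {f : ℍ → ℂ} (hf : Continuous f)
    (hi : ∀ (g : SL(2, ℤ)) (z : ℍ), f (g • z) = f z) {g h : SL(2, ℤ)} (hg : IsPos g)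
    (hh : IsPos h) : loopIntegral f (g * h) = loopIntegral f (h * g) := by
  have h1 := (hg.mul hh).fixPt_pos.le
  have h2 := (hg.mul hh).flip.fixPt_pos.le
  have h3 := (hh.mul hg).fixPt_pos.le
  have h4 := (hh.mul hg).flip.fixPt_pos.le
  have e1 := hg.fixPt_mul_comm hh
  have e2 := hh.fixPt_mul_comm hg
  have e3 := hh.flip.fixPt_mul_comm hg.flip
  have e4 := hg.flip.fixPt_mul_comm hh.flip
  rw [loopIntegral, loopIntegral, arcIntegral_mul hf hi hg hh h1 h2,
    arcIntegral_mul hf hi hh hg h3 h4, swapDiag_mul, swapDiag_mul, e1, e2, e3, e4, add_comm]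

/-! ### Products with a high power -/

lemma IsPos.mul_pow {g h : SL(2, ℤ)} (hg : IsPos g) (hh : IsPos h) (n : ℕ) :
    IsPos (g * h ^ n) := by
  induction n with
  | zero => simpa using hg
  | succ n ih => rw [pow_succ, ← mul_assoc]; exact ih.mul hh

lemma mob_mul_pow {g h : SL(2, ℤ)} (hh : IsPos h) {v : ℝ} (hv : 0 ≤ v) (n : ℕ) :
    mob (g * h ^ n : SL(2, ℤ)) v = mob g ((mob h)^[n] v) := by
  induction n generalizing v with
  | zero => simp
  | succ n ih =>
    rw [pow_succ, ← mul_assoc, mob_mul_pos hh hv, ih (hh.mob_pos hv).le,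
      Function.iterate_succ_apply]

lemma mob_swapDiag_mul_pow {g h : SL(2, ℤ)} (hg : IsPos g) (hh : IsPos h) {q : ℝ} (hq : 0 ≤ q)
    (n : ℕ) : mob (swapDiag (g * h ^ n)) q = (mob (swapDiag h))^[n] (mob (swapDiag g) q) := by
  induction n with
  | zero => simp
  | succ n ih =>
    rw [pow_succ, ← mul_assoc, swapDiag_mul, mob_mul_pos (hg.mul_pow hh n).flip hq, ih,
      Function.iterate_succ_apply']

/-- The `k`-th factor `h`, counted from the right, sees `v` after the `k` factors to its right and
`q` after `g` and the `n - 1 - k` factors to its left. -/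
lemma arcIntegral_mul_pow {f : ℍ → ℂ} (hf : Continuous f)
    (hi : ∀ (g : SL(2, ℤ)) (z : ℍ), f (g • z) = f z) {g h : SL(2, ℤ)} (hg : IsPos g)
    (hh : IsPos h) {v q : ℝ} (hv : 0 ≤ v) (hq : 0 ≤ q) (n : ℕ) :
    arcIntegral f (g * h ^ n) v q = arcIntegral f g ((mob h)^[n] v) q +
      ∑ k ∈ Finset.range n, arcIntegral f h ((mob h)^[k] v)
        ((mob (swapDiag h))^[n - 1 - k] (mob (swapDiag g) q)) := by
  induction n generalizing v with
  | zero => simp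
  | succ n ih =>
    rw [pow_succ, ← mul_assoc, arcIntegral_mul hf hi (hg.mul_pow hh n) hh hv hq,
      ih (hh.mob_pos hv).le, Finset.sum_range_succ', mob_swapDiag_mul_pow hg hh hq, add_assoc]
    congr 2
    refine Finset.sum_congr rfl fun k _ => ?_
    rw [Function.iterate_succ_apply]
    congr 2
    lia

/-- A Cesàro limit for triangular arrays whose entries converge away from the ends of each row. -/
lemma tendsto_average {a : ℕ → ℕ → ℂ} {b : ℕ → ℂ} {A : ℂ} {C : ℝ}
    (hb : ∀ n, ‖b n‖ ≤ C) (ha : ∀ n k, k < n → ‖a n k - A‖ ≤ C)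
    (h : ∀ ε > 0, ∃ N, ∀ n k, N ≤ k → k + N < n → ‖a n k - A‖ ≤ ε) :
    Tendsto (fun n : ℕ => (b n + ∑ k ∈ Finset.range n, a n k) / n) atTop (𝓝 A) := by
  have hC : 0 ≤ C := (norm_nonneg _).trans (hb 0)
  rw [Metric.tendsto_atTop]
  intro ε hε
  obtain ⟨N, hN⟩ := h (ε / 2) (by positivity)
  obtain ⟨m, hm⟩ := exists_nat_gt ((C + 2 * N * C) / (ε / 2))
  refine ⟨m + 1, fun n hn => ?_⟩
  have hn0 : (0 : ℝ) < n := by exact_mod_cast (show 0 < n by lia)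
  have hn1 : (n : ℂ) ≠ 0 := by exact_mod_cast hn0.ne'
  have e : (b n + ∑ k ∈ Finset.range n, a n k) / n - A =
      (b n + ∑ k ∈ Finset.range n, (a n k - A)) / n := by
    rw [Finset.sum_sub_distrib]
    simp
    field_simp
    ring
  have h1 : ‖∑ k ∈ Finset.range n, (a n k - A)‖ ≤ n * (ε / 2) + 2 * N * C := by
    calc _ ≤ ∑ k ∈ Finset.range n, ‖a n k - A‖ := norm_sum_le _ _
      -- The first `N` and the last `N` entries of the row are charged `C`, all others `ε / 2`.
      _ ≤ ∑ k ∈ Finset.range n, (ε / 2 + ((if k < N then C else 0) +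
          if n - 1 - k < N then C else 0)) := by
        refine Finset.sum_le_sum fun k hk => ?_
        have hk := Finset.mem_range.1 hk
        have h2 := ha n k hk
        by_cases hkN : k < N
        · rw [if_pos hkN]
          split_ifs <;> linarith
        · by_cases hkn : n - 1 - k < N
          · rw [if_neg hkN, if_pos hkn]
            linarith
          · rw [if_neg hkN, if_neg hkn]
            have := hN n k (by lia) (by lia)
            linarith
      _ ≤ _ := by
        have h3 : ∑ k ∈ Finset.range n, (if k < N then C else 0) ≤ N * C := by
          rw [← Finset.sum_filter, Finset.sum_const, nsmul_eq_mul]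
          gcongr
          calc _ ≤ (Finset.range N).card := Finset.card_le_card fun k => by simp
            _ = N := Finset.card_range N
        rw [Finset.sum_add_distrib, Finset.sum_add_distrib,
          Finset.sum_range_reflect (fun k => if k < N then C else 0)]
        simp only [Finset.sum_const, Finset.card_range, nsmul_eq_mul]
        linarith
  rw [dist_eq_norm, e, norm_div, Complex.norm_natCast, div_lt_iff₀ hn0]
  have h4 : (C + 2 * N * C) < n * (ε / 2) := by
    rw [div_lt_iff₀ (by positivity)] at hm
    have : (m : ℝ) ≤ n := by exact_mod_cast (show m ≤ n by lia)
    nlinarith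
  have := norm_add_le (b n) (∑ k ∈ Finset.range n, (a n k - A))
  have := hb n
  nlinarith

lemma IsPos.iterate_le {g : SL(2, ℤ)} (hg : IsPos g) {v B : ℝ} (hv : 0 ≤ v) (hB : v ≤ B)
    (hB' : fixPt g ≤ B) (n : ℕ) : (mob g)^[n] v ≤ 2 * B := by
  have h1 := hg.iterate_contract hv n
  have h2 := hg.denom_fixPt_gt
  have h3 : (g 1 0 * fixPt g + g 1 1)⁻¹ ^ n ≤ 1 :=
    pow_le_one₀ (by positivity) (inv_lt_one_of_one_lt₀ h2).le
  have h4 := hg.fixPt_pos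
  have h5 : |v - fixPt g| ≤ B := abs_le.2 ⟨by linarith, by linarith⟩
  have h6 := (abs_le.1 (h1.trans (mul_le_of_le_one_right (abs_nonneg _) h3))).2
  linarith

lemma IsPos.exists_iterate_close {g : SL(2, ℤ)} (hg : IsPos g) (B : ℝ) {δ : ℝ} (hδ : 0 < δ) :
    ∃ N, ∀ n, N ≤ n → ∀ v, 0 ≤ v → v ≤ B → |(mob g)^[n] v - fixPt g| < δ := by
  have h2 := hg.denom_fixPt_gt
  have h4 := hg.fixPt_pos
  have hr : (g 1 0 * fixPt g + g 1 1)⁻¹ < 1 := inv_lt_one_of_one_lt₀ h2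
  have ht := (tendsto_pow_atTop_nhds_zero_of_lt_one (by positivity) hr).const_mul (|B| + fixPt g)
  rw [mul_zero] at ht
  obtain ⟨N, hN⟩ := eventually_atTop.1 (ht.eventually_lt_const hδ)
  refine ⟨N, fun n hn v hv hB => lt_of_le_of_lt ?_ (hN n hn)⟩
  refine (hg.iterate_contract hv n).trans ?_
  have := le_abs_self B
  have : |v - fixPt g| ≤ |B| + fixPt g := abs_le.2 ⟨by linarith, by linarith⟩
  gcongr

lemma tendsto_loopIntegral {f : ℍ → ℂ} (hf : Continuous f)
    (hi : ∀ (g : SL(2, ℤ)) (z : ℍ), f (g • z) = f z) {g h : SL(2, ℤ)} (hg : IsPos g)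
    (hh : IsPos h) :
    Tendsto (fun n : ℕ => loopIntegral f (g * h ^ n) / n) atTop (𝓝 (loopIntegral f h)) := by
  set v : ℕ → ℝ := fun n => fixPt (g * h ^ n) with hv
  set q : ℕ → ℝ := fun n => fixPt (swapDiag (g * h ^ n)) with hq
  set r : ℕ → ℝ := fun n => mob (swapDiag g) (q n) with hr
  have hp (n) := hg.mul_pow hh n
  have hv0 (n) : 0 ≤ v n := (hp n).fixPt_pos.le
  have hq0 (n) : 0 ≤ q n := (hp n).flip.fixPt_pos.le
  have hr0 (n) : 0 ≤ r n := (hg.flip.mob_pos (hq0 n)).le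
  -- The fixed points depend on `n`, but they lie in the image of `g`, which is bounded
  -- independently of `n`; likewise for `r n` below.
  have hvB (n) : v n ≤ g 0 0 + g 0 1 := by
    calc v n = mob g ((mob h)^[n] (v n)) := by
          rw [← mob_mul_pow hh (hv0 n)]; exact (hp n).mob_fixPt.symm
      _ ≤ _ := hg.mob_le (hh.iterate_nonneg (hv0 n) n)
  have hqr (n) : q n = (mob (swapDiag h))^[n] (r n) := by
    rw [← mob_swapDiag_mul_pow hg hh (hq0 n)]
    exact (hp n).flip.mob_fixPt.symm
  have hrB (n) : r n ≤ swapDiag g 0 0 + swapDiag g 0 1 := hg.flip.mob_le (hq0 n)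
  obtain ⟨B, hB1, hB2, hB3, hB4⟩ : ∃ B : ℝ, g 0 0 + g 0 1 ≤ B ∧
      swapDiag g 0 0 + swapDiag g 0 1 ≤ B ∧ fixPt h ≤ B ∧ fixPt (swapDiag h) ≤ B :=
    ⟨max (max (g 0 0 + g 0 1) (swapDiag g 0 0 + swapDiag g 0 1))
      (max (fixPt h) (fixPt (swapDiag h))),
      by simp, by simp, by simp, by simp⟩
  have hK : IsCompact (Set.Icc (0 : ℝ) (2 * B) ×ˢ Set.Icc (0 : ℝ) (2 * B)) :=
    isCompact_Icc.prod isCompact_Icc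
  have hsub : Set.Icc (0 : ℝ) (2 * B) ×ˢ Set.Icc (0 : ℝ) (2 * B) ⊆
      {p : ℝ × ℝ | 0 ≤ p.1 ∧ 0 ≤ p.2} := fun p hp => ⟨hp.1.1, hp.2.1⟩
  obtain ⟨C1, hC1⟩ := hK.exists_bound_of_continuousOn ((continuousOn_arcIntegral hf hg).mono hsub)
  obtain ⟨C2, hC2⟩ := hK.exists_bound_of_continuousOn ((continuousOn_arcIntegral hf hh).mono hsub)
  have hmv (n k) : (mob h)^[k] (v n) ∈ Set.Icc (0 : ℝ) (2 * B) :=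
    ⟨hh.iterate_nonneg (hv0 n) k, hh.iterate_le (hv0 n) ((hvB n).trans hB1) hB3 k⟩
  have hmr (n k) : (mob (swapDiag h))^[k] (r n) ∈ Set.Icc (0 : ℝ) (2 * B) :=
    ⟨hh.flip.iterate_nonneg (hr0 n) k, hh.flip.iterate_le (hr0 n) ((hrB n).trans hB2) hB4 k⟩
  have hform (n) := arcIntegral_mul_pow hf hi hg hh (hv0 n) (hq0 n) n
  -- No direct bound on `q n` is at hand; it is an iterate of the bounded `r n`.
  have hC1' (n) : ‖arcIntegral f g ((mob h)^[n] (v n)) (q n)‖ ≤ C1 := by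
    rw [hqr n]
    exact hC1 (_, _) ⟨hmv n n, hmr n n⟩
  have hC2' (n k) : ‖arcIntegral f h ((mob h)^[k] (v n))
      ((mob (swapDiag h))^[n - 1 - k] (r n))‖ ≤ C2 := hC2 (_, _) ⟨hmv n k, hmr n _⟩
  have hmain := tendsto_average (A := loopIntegral f h)
    (C := max C1 (C2 + ‖loopIntegral f h‖))
    (b := fun n => arcIntegral f g ((mob h)^[n] (v n)) (q n))
    (a := fun n k => arcIntegral f h ((mob h)^[k] (v n)) ((mob (swapDiag h))^[n - 1 - k] (r n)))
    (fun n => (hC1' n).trans (le_max_left _ _))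
    (fun n k _ => ((norm_sub_le _ _).trans (add_le_add_left (hC2' n k) _)).trans
      (le_max_right _ _)) ?_
  · refine hmain.congr fun n => ?_
    rw [loopIntegral, hform]
  · intro ε hε
    have hcw := continuousOn_arcIntegral hf hh (fixPt h, fixPt (swapDiag h))
      ⟨hh.fixPt_pos.le, hh.flip.fixPt_pos.le⟩
    obtain ⟨δ, hδ, hδ'⟩ := Metric.continuousWithinAt_iff.1 hcw ε hε
    obtain ⟨N1, hN1⟩ := hh.exists_iterate_close B hδ
    obtain ⟨N2, hN2⟩ := hh.flip.exists_iterate_close B hδ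
    refine ⟨max N1 N2, fun n k h1 h2 => ?_⟩
    have h3 := hN1 k (by lia) (v n) (hv0 n) ((hvB n).trans hB1)
    have h4 := hN2 (n - 1 - k) (by lia) (r n) (hr0 n) ((hrB n).trans hB2)
    have := hδ' (x := ((mob h)^[k] (v n), (mob (swapDiag h))^[n - 1 - k] (r n)))
      ⟨(hmv n k).1, (hmr n _).1⟩ (max_lt h3 h4)
    rw [dist_eq_norm] at this
    exact this.le

/-! ### The form of a fixed point -/

/-- For a trace `t ≥ 3` the number `t² - 4` lies strictly between `(t - 1)²` and `t²`. -/
lemma IsPos.irrational_rootDisc {g : SL(2, ℤ)} (hg : IsPos g) : Irrational (rootDisc g) := by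
  have ht := hg.trace_ge
  have h : rootDisc g = √(((g 0 0 + g 1 1) ^ 2 - 4 : ℤ) : ℝ) := by
    rw [rootDisc]; push_cast; rfl
  rw [h, irrational_sqrt_intCast_iff]
  refine ⟨?_, by nlinarith⟩
  rintro ⟨r, hr⟩
  rw [← abs_mul_abs_self] at hr
  have h0 := abs_nonneg r
  generalize |r| = x at *
  generalize g 0 0 + g 1 1 = t at *
  rcases lt_or_ge x t with h1 | h1
  · have : x ≤ t - 1 := by lia
    nlinarith
  · nlinarith

lemma IsPos.irrational_fixPt {g : SL(2, ℤ)} (hg : IsPos g) : Irrational (fixPt g) := by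
  have h : rootDisc g = ((2 * g 1 0 : ℤ) : ℝ) * fixPt g + ((g 1 1 - g 0 0 : ℤ) : ℝ) := by
    have := hg.real 1 0
    have h3 : (g 1 0 : ℝ) ≠ 0 := by positivity
    unfold fixPt
    push_cast
    field_simp
    ring
  have hi := hg.irrational_rootDisc
  rw [h] at hi
  exact (hi.of_add_intCast _).of_intCast_mul _

lemma fixPt_sub_fixPt_swapDiag (g : SL(2, ℤ)) :
    fixPt g - fixPt (swapDiag g) = (g 0 0 - g 1 1) / g 1 0 := by
  rw [fixPt, fixPt, rootDisc_swapDiag, swapDiag_00, swapDiag_11, swapDiag_10, ← sub_div]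
  rw [show (g 0 0 - g 1 1 + rootDisc g - (g 1 1 - g 0 0 + rootDisc g) : ℝ) =
    2 * (g 0 0 - g 1 1) by ring, mul_div_mul_left _ _ two_ne_zero]

/-- The form is the fixed point equation divided by the gcd `G` of its coefficients; its leading
coefficient is positive, so the first root is the positive one. -/
lemma IsPos.exists_isFormOf {g : SL(2, ℤ)} (hg : IsPos g) : ∃ Q : QForm, Q.IsFormOf (fixPt g) := by
  have hc := hg 1 0
  set G : ℕ := Int.gcd (g 1 0) (Int.gcd (g 1 1 - g 0 0) (-g 0 1)) with hG
  have hG0 : 0 < G := Int.gcd_pos_of_ne_zero_left _ hc.ne'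
  obtain ⟨a, ha⟩ : (G : ℤ) ∣ g 1 0 := Int.gcd_dvd_left _ _
  have hd : (G : ℤ) ∣ (Int.gcd (g 1 1 - g 0 0) (-g 0 1) : ℤ) := Int.gcd_dvd_right _ _
  obtain ⟨b, hb⟩ : (G : ℤ) ∣ g 1 1 - g 0 0 := hd.trans (Int.gcd_dvd_left _ _)
  obtain ⟨c, hc'⟩ : (G : ℤ) ∣ -g 0 1 := hd.trans (Int.gcd_dvd_right _ _)
  have hG1 : (0 : ℤ) < G := by exact_mod_cast hG0
  have ha0 : 0 < a := by
    rw [ha] at hc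
    exact (mul_pos_iff_of_pos_left hG1).1 hc
  have hgcd : Int.gcd a (Int.gcd b c) = 1 := by
    have h1 : G = G * Int.gcd a (Int.gcd b c) := by
      conv_lhs => rw [hG, ha, hb, hc', Int.gcd_mul_left, Int.natAbs_natCast, Nat.cast_mul,
        Int.gcd_mul_left, Int.natAbs_natCast]
    exact (Nat.eq_of_mul_eq_mul_left hG0 (by rw [mul_one]; exact h1.symm))
  have hdet := g.det_coe
  rw [Matrix.det_fin_two] at hdet
  have hdisc : (G : ℤ) ^ 2 * (b ^ 2 - 4 * a * c) = (g 0 0 + g 1 1) ^ 2 - 4 := by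
    calc (G : ℤ) ^ 2 * (b ^ 2 - 4 * a * c) = (G * b) ^ 2 - 4 * (G * a) * (G * c) := by ring
      _ = (g 1 1 - g 0 0) ^ 2 - 4 * g 1 0 * (-g 0 1) := by rw [← ha, ← hb, ← hc']
      _ = _ := by linear_combination (-4) * hdet
  have ht := hg.trace_ge
  have hD : 0 < b ^ 2 - 4 * a * c := by
    have h1 : 0 < (G : ℤ) ^ 2 * (b ^ 2 - 4 * a * c) := by rw [hdisc]; nlinarith
    exact (mul_pos_iff_of_pos_left (by positivity)).1 h1
  refine ⟨⟨a, b, c⟩, ha0.ne', hgcd, hD, ?_⟩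
  have hr : rootDisc g = G * √((b ^ 2 - 4 * a * c : ℤ) : ℝ) := by
    rw [rootDisc, show ((g 0 0 + g 1 1) ^ 2 - 4 : ℝ) = (((g 0 0 + g 1 1) ^ 2 - 4 : ℤ) : ℝ) by
      push_cast; rfl, ← hdisc, Int.cast_mul, Real.sqrt_mul (by positivity)]
    congr 1
    rw [Int.cast_pow, Int.cast_natCast, Real.sqrt_sq (by positivity)]
  have e1 : (g 1 0 : ℝ) = G * a := by exact_mod_cast ha
  have e2 : (g 0 0 - g 1 1 : ℝ) = -(G * b) := by
    have : (g 1 1 - g 0 0 : ℝ) = G * b := by exact_mod_cast hb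
    linarith
  have hGr : (G : ℝ) ≠ 0 := by positivity
  have har : (a : ℝ) ≠ 0 := by exact_mod_cast ha0.ne'
  rw [fixPt, hr, e1, e2, QForm.root, QForm.disc]
  field_simp

lemma QForm.root_eq {Q : QForm} (ha : Q.a ≠ 0) (hD : 0 < Q.disc) :
    (Q.a * Q.root ^ 2 + Q.b * Q.root + Q.c : ℝ) = 0 := by
  have h := Real.sq_sqrt (show (0 : ℝ) ≤ Q.disc by exact_mod_cast hD.le)
  have ha' : (Q.a : ℝ) ≠ 0 := by exact_mod_cast ha
  have hd : (Q.disc : ℝ) = Q.b ^ 2 - 4 * Q.a * Q.c := by rw [QForm.disc]; push_cast; ring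
  unfold QForm.root
  field_simp
  linear_combination h + hd

lemma QForm.root_sub_conjRoot (Q : QForm) : Q.root - Q.conjRoot = √(Q.disc : ℝ) / Q.a := by
  rw [QForm.root, QForm.conjRoot, ← sub_div, show (-Q.b + √(Q.disc : ℝ) - (-Q.b - √(Q.disc : ℝ))) =
    2 * √(Q.disc : ℝ) by ring, mul_div_mul_left _ _ two_ne_zero]

lemma QForm.root_add_conjRoot (Q : QForm) : Q.root + Q.conjRoot = -Q.b / Q.a := by
  rw [QForm.root, QForm.conjRoot, ← add_div, show (-Q.b + √(Q.disc : ℝ) + (-Q.b - √(Q.disc : ℝ))) =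
    2 * -(Q.b : ℝ) by ring, mul_div_mul_left _ _ two_ne_zero]

lemma QForm.conjRoot_eq {Q : QForm} (ha : Q.a ≠ 0) (hD : 0 < Q.disc) :
    (Q.a * Q.conjRoot ^ 2 + Q.b * Q.conjRoot + Q.c : ℝ) = 0 := by
  have h := QForm.root_eq ha hD
  have h2 := Q.root_add_conjRoot
  have ha' : (Q.a : ℝ) ≠ 0 := by exact_mod_cast ha
  rw [eq_div_iff ha'] at h2
  linear_combination h + (Q.conjRoot - Q.root) * h2

/-- Eliminating the square between the two quadratic equations leaves a linear relation for an
irrational number, so the forms are proportional. Primitivity of `Q` makes the factor an integer. -/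
lemma IsPos.form_eq {g : SL(2, ℤ)} (hg : IsPos g) {Q : QForm} (hQ : Q.IsFormOf (fixPt g)) :
    ∃ u : ℤ, u ≠ 0 ∧ g 1 0 = u * Q.a ∧ g 1 1 - g 0 0 = u * Q.b ∧ -g 0 1 = u * Q.c := by
  obtain ⟨ha, hgcd, hD, hw⟩ := hQ
  have h1 := QForm.root_eq ha hD
  rw [← hw] at h1
  have h2 := hg.fixPt_eq
  have hirr := hg.irrational_fixPt
  have h3 : ((g 1 0 * Q.b - Q.a * (g 1 1 - g 0 0) : ℤ) : ℝ) * fixPt g +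
      ((g 1 0 * Q.c + Q.a * g 0 1 : ℤ) : ℝ) = 0 := by
    push_cast
    linear_combination g 1 0 * h1 - Q.a * h2
  have h4 : g 1 0 * Q.b - Q.a * (g 1 1 - g 0 0) = 0 := by
    by_contra hne
    exact ((hirr.intCast_mul hne).add_intCast _).ne_zero h3
  have h5 : g 1 0 * Q.c + Q.a * g 0 1 = 0 := by
    rw [h4, Int.cast_zero, zero_mul, zero_add] at h3
    exact_mod_cast h3
  have hdvd : Q.a ∣ g 1 0 := by
    have e1 : Q.a ∣ g 1 0 * Q.a := Dvd.intro_left _ rfl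
    have e2 : Q.a ∣ g 1 0 * Q.b := ⟨g 1 1 - g 0 0, by linarith⟩
    have e3 : Q.a ∣ g 1 0 * Q.c := ⟨-g 0 1, by linarith⟩
    have e4 : Q.a ∣ g 1 0 * (Int.gcd Q.b Q.c : ℤ) := by
      rw [Int.gcd_eq_gcd_ab, mul_add, ← mul_assoc, ← mul_assoc]
      exact dvd_add (e2.mul_right _) (e3.mul_right _)
    have e5 : Q.a ∣ g 1 0 * (Int.gcd Q.a (Int.gcd Q.b Q.c) : ℤ) := by
      rw [Int.gcd_eq_gcd_ab, mul_add, ← mul_assoc, ← mul_assoc]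
      exact dvd_add (e1.mul_right _) (e4.mul_right _)
    rwa [hgcd, Nat.cast_one, mul_one] at e5
  obtain ⟨u, hu⟩ := hdvd
  refine ⟨u, ?_, by rw [hu, mul_comm], ?_, ?_⟩
  · rintro rfl
    have := hg 1 0
    simp [hu] at this
  · apply mul_left_cancel₀ ha
    rw [hu] at h4
    linarith
  · apply mul_left_cancel₀ ha
    rw [hu] at h5
    linarith

lemma IsPos.conjRoot_eq {g : SL(2, ℤ)} (hg : IsPos g) {Q : QForm} (hQ : Q.IsFormOf (fixPt g)) :
    Q.conjRoot = -fixPt (swapDiag g) := by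
  obtain ⟨u, hu, h1, h2, -⟩ := hg.form_eq hQ
  have h3 := Q.root_add_conjRoot
  have h4 := fixPt_sub_fixPt_swapDiag g
  have hu' : (u : ℝ) ≠ 0 := by exact_mod_cast hu
  have e1 : (g 1 0 : ℝ) = u * Q.a := by exact_mod_cast h1
  have e2 : (g 0 0 - g 1 1 : ℝ) = u * -Q.b := by
    have : (g 1 1 - g 0 0 : ℝ) = u * Q.b := by exact_mod_cast h2
    linarith
  rw [e1, e2, mul_div_mul_left _ _ hu', ← h3, ← hQ.2.2.2] at h4
  linarith

/-! ### The smallest solution of the Pell equation -/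

/-- `pellT` and `pellU` are minimized separately. On solutions `t` and `u` increase together, so one
solution attains both minima. -/
lemma pell_spec {D : ℤ} (hD : 0 < D)
    (h : ∃ t u : ℕ, 0 < t ∧ 0 < u ∧ (t : ℤ) ^ 2 - D * (u : ℤ) ^ 2 = 4) :
    0 < pellT D ∧ 0 < pellU D ∧ (pellT D : ℤ) ^ 2 - D * (pellU D : ℤ) ^ 2 = 4 := by
  obtain ⟨t, u, ht, hu, htu⟩ := h
  obtain ⟨ht0, u1, hu1, e1⟩ :
      pellT D ∈ {t : ℕ | 0 < t ∧ ∃ u : ℕ, 0 < u ∧ (t : ℤ) ^ 2 - D * (u : ℤ) ^ 2 = 4} :=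
    Nat.sInf_mem ⟨t, ht, u, hu, htu⟩
  obtain ⟨hu0, t1, ht1, e2⟩ :
      pellU D ∈ {u : ℕ | 0 < u ∧ ∃ t : ℕ, 0 < t ∧ (t : ℤ) ^ 2 - D * (u : ℤ) ^ 2 = 4} :=
    Nat.sInf_mem ⟨u, hu, t, ht, htu⟩
  have h1 : pellT D ≤ t1 := Nat.sInf_le ⟨ht1, pellU D, hu0, e2⟩
  have h2 : pellU D ≤ u1 := Nat.sInf_le ⟨hu1, pellT D, ht0, e1⟩
  have h3 : u1 ≤ pellU D := by
    have h1' : (pellT D : ℤ) ^ 2 ≤ (t1 : ℤ) ^ 2 := by gcongr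
    have h4 : (u1 : ℤ) ^ 2 ≤ (pellU D : ℤ) ^ 2 := by
      have : D * (u1 : ℤ) ^ 2 ≤ D * (pellU D : ℤ) ^ 2 := by linarith
      exact le_of_mul_le_mul_left this hD
    exact_mod_cast (sq_le_sq₀ (by positivity) (by positivity)).1 h4
  rw [le_antisymm h2 h3]
  exact ⟨ht0, hu1, e1⟩

lemma IsPos.pell_spec {g : SL(2, ℤ)} (hg : IsPos g) {Q : QForm} (hQ : Q.IsFormOf (fixPt g)) :
    0 < pellT Q.disc ∧ 0 < pellU Q.disc ∧
      (pellT Q.disc : ℤ) ^ 2 - Q.disc * (pellU Q.disc : ℤ) ^ 2 = 4 := by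
  obtain ⟨u, hu, h1, h2, h3⟩ := hg.form_eq hQ
  apply MarkovCycle.pell_spec hQ.2.2.1
  have ht := hg.trace_ge
  have hdet := g.det_coe
  rw [Matrix.det_fin_two] at hdet
  refine ⟨(g 0 0 + g 1 1).natAbs, u.natAbs, by lia, by lia, ?_⟩
  rw [Int.natCast_natAbs, Int.natCast_natAbs, sq_abs, sq_abs, QForm.disc]
  have : (Q.b ^ 2 - 4 * Q.a * Q.c) * u ^ 2 = (u * Q.b) ^ 2 - 4 * (u * Q.a) * (u * Q.c) := by ring
  rw [this, ← h1, ← h2, ← h3]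
  linear_combination 4 * hdet

/-- The generator of the stabilizer of the roots of `Q`. -/
lemma exists_automorph {Q : QForm} {t u : ℤ} (h : t ^ 2 - Q.disc * u ^ 2 = 4) :
    ∃ A : SL(2, ℤ), A 1 0 = Q.a * u ∧ A 0 1 = -Q.c * u ∧ 2 * A 1 1 = t + Q.b * u ∧
      2 * A 0 0 = t - Q.b * u := by
  rw [QForm.disc] at h
  obtain ⟨m, hm⟩ : Even (t + Q.b * u) := by
    have : Even ((t + Q.b * u) ^ 2) :=
      ⟨2 + t * Q.b * u + Q.b ^ 2 * u ^ 2 - 2 * Q.a * Q.c * u ^ 2, by linear_combination h⟩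
    exact (Int.even_pow.1 this).1
  refine ⟨⟨!![m - Q.b * u, -Q.c * u; Q.a * u, m], ?_⟩, rfl, rfl, ?_, ?_⟩
  · rw [Matrix.det_fin_two]
    simp only [of_apply, cons_val', cons_val_zero, cons_val_one, cons_val_fin_one]
    obtain rfl : t = 2 * m - Q.b * u := by linarith
    linarith
  · change 2 * m = _
    linarith
  · change 2 * (m - Q.b * u) = _
    linarith

/-! ### Comparison of the cycle integral with the loop integral -/

/-- Both sides are the double integral of `φ (s + t)` over a rectangle with sides `p` and `q`. The
ratio of the periods need not be known. -/
lemma periodic_mean_eq {φ : ℝ → ℂ} (hφ : Continuous φ) {p q : ℝ}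
    (hp : Function.Periodic φ p) (hq : Function.Periodic φ q) :
    (p : ℂ) * ∫ s in (0 : ℝ)..q, φ s = q * ∫ s in (0 : ℝ)..p, φ s := by
  have key {p q : ℝ} (hq : Function.Periodic φ q) :
      ∫ t in (0 : ℝ)..p, ∫ s in (0 : ℝ)..q, φ (s + t) = (p : ℂ) * ∫ s in (0 : ℝ)..q, φ s := by
    have (t : ℝ) : ∫ s in (0 : ℝ)..q, φ (s + t) = ∫ s in (0 : ℝ)..q, φ s := by
      rw [intervalIntegral.integral_comp_add_right, add_comm q, zero_add,
        hq.intervalIntegral_add_eq t 0, zero_add]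
    simp [this]
  rw [← key hq, ← key hp, MeasureTheory.intervalIntegral_intervalIntegral_swap]
  · simp_rw [add_comm]
  · have : Continuous (Function.uncurry fun x y => φ (y + x)) := by
      exact hφ.comp (continuous_snd.add continuous_fst)
    exact (this.continuousOn.integrableOn_compact (isCompact_uIcc.prod isCompact_uIcc)).mono_set
      (Set.prod_mono Set.uIoc_subset_uIcc Set.uIoc_subset_uIcc)

lemma hasDerivAt_geo (w w' s : ℝ) : HasDerivAt (geo w w')
    (Complex.I * (Real.exp s : ℝ) * (w - w') / (1 - Complex.I * (Real.exp s : ℝ)) ^ 2) s := by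
  have he : HasDerivAt (fun s : ℝ => ((Real.exp s : ℝ) : ℂ)) (Real.exp s : ℝ) s :=
    (Real.hasDerivAt_exp s).ofReal_comp
  have h1 := ((he.const_mul Complex.I).mul_const (w' : ℂ)).const_sub (w : ℂ)
  have h2 := (he.const_mul Complex.I).const_sub 1
  refine (h1.div h2 (one_sub_I_mul_ne_zero _)).congr_deriv ?_
  congr 1
  ring

/-- With `√D = a (w - w')` and `Q(z, 1) = a (z - w)(z - w')`, the form `√D dz / Q` is `d log ((z -
w) / (z - w'))`, and on the geodesic this quotient equals `i exp s`. -/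
lemma integrand_eq {Q : QForm} (ha : Q.a ≠ 0) (hD : 0 < Q.disc) (h : Q.conjRoot < Q.root)
    (z : ℂ) (s : ℝ) :
    (√(Q.disc : ℝ) : ℂ) * z / Q.eval (geo Q.root Q.conjRoot s) *
      deriv (geo Q.root Q.conjRoot) s = z := by
  have ha' : (Q.a : ℂ) ≠ 0 := by exact_mod_cast ha
  have ha'' : (Q.a : ℝ) ≠ 0 := by exact_mod_cast ha
  have h1 := one_sub_I_mul_ne_zero (Real.exp s)
  have hE : ((Real.exp s : ℝ) : ℂ) ≠ 0 := by exact_mod_cast (Real.exp_pos s).ne'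
  have hw : (Q.root - Q.conjRoot : ℂ) ≠ 0 := by exact_mod_cast (sub_pos.2 h).ne'
  have hs : (√(Q.disc : ℝ) : ℂ) = Q.a * (Q.root - Q.conjRoot) := by
    have := Q.root_sub_conjRoot
    rw [eq_div_iff ha''] at this
    rw [← Complex.ofReal_sub, ← Complex.ofReal_intCast, ← Complex.ofReal_mul, ← this, mul_comm]
  have hb : (Q.b : ℂ) = -Q.a * (Q.root + Q.conjRoot) := by
    have := Q.root_add_conjRoot
    rw [eq_div_iff ha''] at this
    have : (Q.b : ℝ) = -Q.a * (Q.root + Q.conjRoot) := by linarith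
    exact_mod_cast this
  have hc : (Q.c : ℂ) = Q.a * Q.root * Q.conjRoot := by
    have h2 := Q.root_add_conjRoot
    rw [eq_div_iff ha''] at h2
    have h3 := QForm.root_eq ha hD
    have : (Q.c : ℝ) = Q.a * Q.root * Q.conjRoot := by
      linear_combination h3 - Q.root * h2
    exact_mod_cast this
  have he : Q.eval (geo Q.root Q.conjRoot s) = Q.a * (Complex.I * (Real.exp s : ℝ) *
      (Q.root - Q.conjRoot) ^ 2 / (1 - Complex.I * (Real.exp s : ℝ)) ^ 2) := by
    rw [QForm.eval, hb, hc, geo]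
    field_simp
    ring
  rw [(hasDerivAt_geo _ _ s).deriv, he, hs]
  have := Complex.I_ne_zero
  field_simp

lemma cycleIntegral_eq {f : ℍ → ℂ} {g : SL(2, ℤ)} (hg : IsPos g) :
    cycleIntegral f (fixPt g) = ∫ s in (0 : ℝ)..2 * Real.log (fundUnit (quadForm (fixPt g)).disc),
      alongGeo f (fixPt g) (-fixPt (swapDiag g)) s := by
  have hQ : (quadForm (fixPt g)).IsFormOf (fixPt g) := Classical.epsilon_spec hg.exists_isFormOf
  have hr := hg.conjRoot_eq hQ
  unfold cycleIntegral
  generalize quadForm (fixPt g) = Q at *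
  have hlt : Q.conjRoot < Q.root := by
    rw [hr, ← hQ.2.2.2]
    linarith [hg.fixPt_pos, hg.flip.fixPt_pos]
  have hγ : geodesic Q.root Q.conjRoot = geo Q.root Q.conjRoot := funext (geodesic_eq_geo hlt)
  dsimp only
  rw [hγ]
  simp_rw [integrand_eq hQ.1 hQ.2.2.1 hlt]
  rw [← hr, hQ.2.2.2]
  rfl

lemma one_lt_fundUnit {D : ℤ} (hD : 0 < D) (hu : 0 < pellU D)
    (h : (pellT D : ℤ) ^ 2 - D * (pellU D : ℤ) ^ 2 = 4) : 1 < fundUnit D := by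
  have h1 : 0 < D * (pellU D : ℤ) ^ 2 := by positivity
  have h2 : (2 : ℤ) < pellT D := by nlinarith
  have h3 : (2 : ℝ) < pellT D := by exact_mod_cast h2
  have : 0 ≤ pellU D * √(D : ℝ) := by positivity
  rw [fundUnit]
  linarith

/-- The automorph of `Q` has denominators `ε` and `ε⁻¹` at the two roots, so it shifts the parameter
by `log (ε / ε⁻¹)`. -/
lemma periodic_fundUnit {f : ℍ → ℂ} (hi : ∀ (g : SL(2, ℤ)) (z : ℍ), f (g • z) = f z)
    {Q : QForm} (ha : Q.a ≠ 0) (hD : 0 < Q.disc) (hlt : Q.conjRoot < Q.root)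
    (hu : 0 < pellU Q.disc)
    (h : (pellT Q.disc : ℤ) ^ 2 - Q.disc * (pellU Q.disc : ℤ) ^ 2 = 4) :
    Function.Periodic (alongGeo f Q.root Q.conjRoot) (2 * Real.log (fundUnit Q.disc)) := by
  obtain ⟨A, h10, h01, h11, h00⟩ := exists_automorph h
  have hε := one_lt_fundUnit hD hu h
  have hsq := Real.sq_sqrt (show (0 : ℝ) ≤ Q.disc by exact_mod_cast hD.le)
  have ha' : (Q.a : ℝ) ≠ 0 := by exact_mod_cast ha
  have r10 : (A 1 0 : ℝ) = Q.a * pellU Q.disc := by exact_mod_cast h10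
  have r01 : (A 0 1 : ℝ) = -Q.c * pellU Q.disc := by exact_mod_cast h01
  have r11 : (A 1 1 : ℝ) = (pellT Q.disc + Q.b * pellU Q.disc) / 2 := by
    rw [eq_div_iff two_ne_zero, mul_comm]
    exact_mod_cast h11
  have r00 : (A 0 0 : ℝ) = (pellT Q.disc - Q.b * pellU Q.disc) / 2 := by
    rw [eq_div_iff two_ne_zero, mul_comm]
    exact_mod_cast h00
  have hr : (pellT Q.disc : ℝ) ^ 2 - Q.disc * (pellU Q.disc : ℝ) ^ 2 = 4 := by exact_mod_cast h
  have e1 : (A 1 0 * Q.root + A 1 1 : ℝ) = fundUnit Q.disc := by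
    rw [r10, r11, QForm.root, fundUnit]
    field_simp
    ring
  have e2 : (A 1 0 * Q.conjRoot + A 1 1 : ℝ) = (fundUnit Q.disc)⁻¹ := by
    apply eq_inv_of_mul_eq_one_left
    rw [r10, r11, QForm.conjRoot, fundUnit]
    field_simp
    linear_combination hr - (pellU Q.disc : ℝ) ^ 2 * hsq
  have m1 : mob A Q.root = Q.root := by
    rw [mob, div_eq_iff (by rw [e1]; positivity), r10, r11, r00, r01]
    linear_combination (-(pellU Q.disc : ℝ)) * QForm.root_eq ha hD
  have m2 : mob A Q.conjRoot = Q.conjRoot := by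
    rw [mob, div_eq_iff (by rw [e2]; positivity), r10, r11, r00, r01]
    linear_combination (-(pellU Q.disc : ℝ)) * QForm.conjRoot_eq ha hD
  intro s
  rw [alongGeo_smul hi A hlt (by rw [e1]; positivity) (by rw [e2]; positivity), m1, m2, e1, e2,
    div_inv_eq_mul, Real.log_mul (by positivity) (by positivity)]
  congr 1
  ring

lemma IsPos.displacement_fixPt_pos {g : SL(2, ℤ)} (hg : IsPos g) :
    0 < displacement g (fixPt g) (fixPt (swapDiag g)) := by
  have h1 : 1 < den g (fixPt g) := hg.denom_fixPt_gt
  have h2 : 1 < den (swapDiag g) (fixPt (swapDiag g)) := hg.flip.denom_fixPt_gt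
  exact Real.log_pos (by nlinarith)

lemma loopIntegral_one (g : SL(2, ℤ)) :
    loopIntegral (fun _ => 1) g = displacement g (fixPt g) (fixPt (swapDiag g)) := by
  simp [loopIntegral, arcIntegral, alongGeo]

lemma periodic_displacement {f : ℍ → ℂ} (hi : ∀ (g : SL(2, ℤ)) (z : ℍ), f (g • z) = f z)
    {g : SL(2, ℤ)} (hg : IsPos g) : Function.Periodic (alongGeo f (fixPt g) (-fixPt (swapDiag g)))
      (displacement g (fixPt g) (fixPt (swapDiag g))) := by
  intro s
  have h := alongGeo_mob hi hg hg.fixPt_pos.le hg.flip.fixPt_pos.le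
    (s + displacement g (fixPt g) (fixPt (swapDiag g)))
  rwa [hg.mob_fixPt, hg.flip.mob_fixPt, add_sub_cancel_right] at h

lemma loopIntegral_eq {f : ℍ → ℂ} (hi : ∀ (g : SL(2, ℤ)) (z : ℍ), f (g • z) = f z)
    {g : SL(2, ℤ)} (hg : IsPos g) : loopIntegral f g =
      ∫ s in (0 : ℝ)..displacement g (fixPt g) (fixPt (swapDiag g)),
        alongGeo f (fixPt g) (-fixPt (swapDiag g)) s := by
  have h := (periodic_displacement hi hg).intervalIntegral_add_eq
    (-displacement g (fixPt g) (fixPt (swapDiag g))) 0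
  rw [neg_add_cancel, zero_add] at h
  rw [loopIntegral, arcIntegral, hg.mob_fixPt, h]

lemma norValue_fixPt {f : ℍ → ℂ} (hf : Continuous f)
    (hi : ∀ (g : SL(2, ℤ)) (z : ℍ), f (g • z) = f z) {g : SL(2, ℤ)} (hg : IsPos g) :
    norValue f (fixPt g) = loopIntegral f g / loopIntegral (fun _ => 1) g := by
  have hQ : (quadForm (fixPt g)).IsFormOf (fixPt g) := Classical.epsilon_spec hg.exists_isFormOf
  have hr := hg.conjRoot_eq hQ
  obtain ⟨-, hu, hpell⟩ := hg.pell_spec hQ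
  have hlt : -fixPt (swapDiag g) < fixPt g := by linarith [hg.fixPt_pos, hg.flip.fixPt_pos]
  rw [norValue, cycleIntegral_eq hg, loopIntegral_one g, loopIntegral_eq hi hg]
  have hlt' : (quadForm (fixPt g)).conjRoot < (quadForm (fixPt g)).root := by
    rwa [hr, ← hQ.2.2.2]
  have hper := periodic_fundUnit hi hQ.1 hQ.2.2.1 hlt' hu hpell
  rw [← hQ.2.2.2, hr] at hper
  have hε := Real.log_pos (one_lt_fundUnit hQ.2.2.1 hu hpell)
  have hd := hg.displacement_fixPt_pos
  rw [div_eq_div_iff (by exact_mod_cast (by positivity)) (by exact_mod_cast hd.ne'), mul_comm,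
    periodic_mean_eq (continuous_alongGeo_right hf hlt) (periodic_displacement hi hg) hper,
    mul_comm]

lemma tendsto_norValue {f : ℍ → ℂ} (hf : Continuous f)
    (hi : ∀ (g : SL(2, ℤ)) (z : ℍ), f (g • z) = f z) {g h : SL(2, ℤ)} (hg : IsPos g)
    (hh : IsPos h) :
    Tendsto (fun n : ℕ => norValue f (fixPt (g * h ^ n))) atTop (𝓝 (norValue f (fixPt h))) := by
  have h1 := tendsto_loopIntegral hf hi hg hh
  have h2 := tendsto_loopIntegral (f := fun _ => 1) continuous_const (fun _ _ => rfl) hg hh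
  rw [norValue_fixPt hf hi hh]
  refine (h1.div h2 ?_).congr' ?_
  · rw [loopIntegral_one h]
    exact_mod_cast hh.displacement_fixPt_pos.ne'
  · filter_upwards [eventually_ne_atTop 0] with n hn
    rw [norValue_fixPt hf hi (hg.mul_pow hh n), Pi.div_apply,
      div_div_div_cancel_right₀ (by exact_mod_cast hn)]

lemma norValue_fixPt_mul_comm {f : ℍ → ℂ} (hf : Continuous f)
    (hi : ∀ (g : SL(2, ℤ)) (z : ℍ), f (g • z) = f z) {g h : SL(2, ℤ)} (hg : IsPos g)
    (hh : IsPos h) : norValue f (fixPt (g * h)) = norValue f (fixPt (h * g)) := by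
  rw [norValue_fixPt hf hi (hg.mul hh), norValue_fixPt hf hi (hh.mul hg),
    loopIntegral_mul_comm hf hi hg hh,
    loopIntegral_mul_comm continuous_const (fun _ _ => rfl) hg hh]

/-! ### Periodic continued fractions -/

/-- The matrix of a word in the digits of a continued fraction. -/
def wordMat : List ℕ → Matrix (Fin 2) (Fin 2) ℤ
  | [] => 1
  | s :: l => !![(s : ℤ), 1; 1, 0] * wordMat l

lemma wordMat_append (l m : List ℕ) : wordMat (l ++ m) = wordMat l * wordMat m := by
  induction l with
  | nil => simp [wordMat]
  | cons s l ih => rw [List.cons_append, wordMat, wordMat, ih, Matrix.mul_assoc]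

lemma mob_wordMat_cons (s : ℕ) (l : List ℕ) {v : ℝ}
    (h0 : (0 : ℝ) < wordMat l 0 0 * v + wordMat l 0 1)
    (h1 : (0 : ℝ) < wordMat l 1 0 * v + wordMat l 1 1) :
    mob (wordMat (s :: l)) v = s + 1 / mob (wordMat l) v := by
  rw [wordMat, mob_mul _ _ h1.ne']
  have hm : 0 < mob (wordMat l) v := div_pos h0 h1
  generalize mob (wordMat l) v = x at *
  simp only [mob, of_apply, cons_val', cons_val_zero, cons_val_one, cons_val_fin_one]
  push_cast
  field_simp
  ring

lemma wordMat_num_den_pos (l : List ℕ) {v : ℝ} (hv : 0 < v) :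
    (0 : ℝ) < wordMat l 0 0 * v + wordMat l 0 1 ∧
      (0 : ℝ) < wordMat l 1 0 * v + wordMat l 1 1 := by
  induction l with
  | nil => simpa [wordMat] using hv
  | cons s l ih =>
    obtain ⟨h0, h1⟩ := ih
    have h2 : (0 : ℝ) ≤ s * (wordMat l 0 0 * v + wordMat l 0 1) := by positivity
    simp only [wordMat, Matrix.mul_apply, Fin.sum_univ_two, of_apply, cons_val', cons_val_zero,
      cons_val_one, cons_val_fin_one]
    push_cast
    constructor <;> linarith

lemma convergent_pos {a : ℕ → ℕ} (ha : ∀ i, 0 < a i) (n : ℕ) : 0 < convergent a n := by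
  induction n generalizing a with
  | zero => exact Nat.cast_pos.2 (ha 0)
  | succ n ih =>
    have := ih fun i => ha (i + 1)
    have := ha 0
    rw [convergent]
    positivity

lemma convergent_add (l : List ℕ) {a : ℕ → ℕ} (ha : ∀ i, 0 < a i)
    (hl : ∀ i (h : i < l.length), a i = l[i]) (n : ℕ) :
    convergent a (n + l.length) =
      mob (wordMat l) (convergent (fun i => a (i + l.length)) n) := by
  induction l generalizing a with
  | nil => simp [wordMat, mob]
  | cons s l ih =>
    have hc := convergent_pos (fun i => ha (i + (l.length + 1))) n
    obtain ⟨h0, h1⟩ := wordMat_num_den_pos l hc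
    have hs : a 0 = s := hl 0 (by simp)
    rw [List.length_cons, mob_wordMat_cons s l h0 h1, ← add_assoc, convergent, hs,
      ih (fun i => ha (i + 1)) fun i h => hl (i + 1) (by simpa using h)]
    rfl

/-- A nonempty word of even length in positive digits. -/
def IsWord (l : List ℕ) : Prop := l ≠ [] ∧ Even l.length ∧ ∀ x ∈ l, 0 < x

lemma IsWord.append {l m : List ℕ} (hl : IsWord l) (hm : IsWord m) : IsWord (l ++ m) := by
  refine ⟨by simp [hl.1], ?_, fun x hx => ?_⟩
  · rw [List.length_append]
    exact hl.2.1.add hm.2.1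
  · rcases List.mem_append.1 hx with h | h
    · exact hl.2.2 x h
    · exact hm.2.2 x h

/-- A single digit gives determinant -1 and a zero entry, so digits are taken in pairs. -/
lemma IsWord.exists_isPos {l : List ℕ} (hl : IsWord l) :
    ∃ g : SL(2, ℤ), IsPos g ∧ (g : Matrix (Fin 2) (Fin 2) ℤ) = wordMat l := by
  obtain ⟨hne, ⟨k, hk⟩, hpos⟩ := hl
  have two (s t : ℕ) (hs : 0 < s) (ht : 0 < t) :
      ∃ g : SL(2, ℤ), IsPos g ∧ (g : Matrix (Fin 2) (Fin 2) ℤ) = wordMat [s, t] := by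
    have hm : wordMat [s, t] = !![(s : ℤ) * t + 1, (s : ℤ); (t : ℤ), 1] := by
      simp [wordMat]
    refine ⟨⟨wordMat [s, t], by rw [hm, Matrix.det_fin_two_of]; ring⟩, ?_, rfl⟩
    intro i j
    change 0 < wordMat [s, t] i j
    rw [hm]
    fin_cases i <;> fin_cases j <;> simp <;> positivity
  induction k generalizing l with
  | zero => exact absurd (List.length_eq_zero_iff.1 hk) hne
  | succ k ih =>
    match l, hk, hpos with
    | [], hk, _ => simp at hk
    | [s], hk, _ => simp only [List.length_cons, List.length_nil] at hk; lia
    | [s, t], _, hpos => exact two s t (hpos s (by simp)) (hpos t (by simp))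
    | s :: t :: u :: m, hk, hpos =>
      obtain ⟨g, hg, eg⟩ := two s t (hpos s (by simp)) (hpos t (by simp))
      obtain ⟨h, hh, eh⟩ := ih (l := u :: m) (by simp)
        (fun x hx => hpos x (List.mem_cons_of_mem _ (List.mem_cons_of_mem _ hx)))
        (by simp only [List.length_cons] at hk ⊢; lia)
      refine ⟨g * h, hg.mul hh, ?_⟩
      change g.1 * h.1 = wordMat ([s, t] ++ u :: m)
      rw [wordMat_append, ← eg, ← eh]

/-- Along each residue class modulo the period length the convergents are iterates of `mob g`. The
finitely many starting values are bounded, so all classes converge uniformly to the fixed point. -/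
lemma IsWord.periodicCF_eq {l : List ℕ} (hl : IsWord l) {g : SL(2, ℤ)} (hg : IsPos g)
    (e : (g : Matrix (Fin 2) (Fin 2) ℤ) = wordMat l) : periodicCF l = fixPt g := by
  have hL : 0 < l.length := List.length_pos_of_ne_nil hl.1
  set a : ℕ → ℕ := fun i => l.getD (i % l.length) 0 with ha
  have hget (i) (h : i < l.length) : a i = l[i] := by
    simp [ha, Nat.mod_eq_of_lt h, h]
  have hper (i) : a (i + l.length) = a i := by simp [ha]
  have hpos (i) : 0 < a i := by
    have h := Nat.mod_lt i hL
    rw [ha]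
    dsimp only
    rw [List.getD_eq_getElem _ _ h]
    exact hl.2.2 _ (List.getElem_mem h)
  have hstep (n) : convergent a (n + l.length) = mob g (convergent a n) := by
    rw [convergent_add l hpos hget, ← e]
    simp_rw [hper]
  have hiter (r k) : convergent a (r + l.length * k) = (mob g)^[k] (convergent a r) := by
    induction k with
    | zero => simp
    | succ k ih => rw [mul_add_one, ← add_assoc, hstep, ih, Function.iterate_succ_apply']
  obtain ⟨B, hB⟩ : ∃ B, ∀ r < l.length, convergent a r ≤ B :=
    ⟨∑ r ∈ Finset.range l.length, convergent a r, fun r hr =>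
      Finset.single_le_sum (fun i _ => (convergent_pos hpos i).le) (Finset.mem_range.2 hr)⟩
  apply Tendsto.limUnder_eq
  rw [Metric.tendsto_atTop]
  intro ε hε
  obtain ⟨N, hN⟩ := hg.exists_iterate_close B hε
  refine ⟨l.length * N, fun n hn => ?_⟩
  rw [← Nat.mod_add_div n l.length, hiter, Real.dist_eq]
  exact hN _ ((Nat.le_div_iff_mul_le hL).2 (by rwa [mul_comm])) _ (convergent_pos hpos _).le
    (hB _ (Nat.mod_lt n hL))

/-! ### Branches of the Markov tree -/

lemma isWord_vertexAt (p : List Dir) :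
    IsWord (vertexAt p).leftPred ∧ IsWord (vertexAt p).rightPred := by
  induction p using List.reverseRecOn with
  | nil => constructor <;> exact ⟨by simp [vertexAt, topVertex], by simp [vertexAt, topVertex],
      by simp [vertexAt, topVertex]⟩
  | append_singleton p d ih =>
    have h : vertexAt (p ++ [d]) = (vertexAt p).child d := by simp [vertexAt]
    rw [h]
    cases d
    · exact ⟨ih.1, ih.2.append ih.1⟩
    · exact ⟨ih.2.append ih.1, ih.2⟩

/-- The `n`-fold repetition of a word. -/
def repeatWord (l : List ℕ) (n : ℕ) : List ℕ := (List.replicate n l).flatten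

lemma repeatWord_succ (l : List ℕ) (n : ℕ) : repeatWord l (n + 1) = l ++ repeatWord l n := rfl

lemma vertexAt_append_left (p : List Dir) (n : ℕ) :
    vertexAt (p ++ List.replicate n Dir.left) =
      ⟨(vertexAt p).leftPred, (vertexAt p).rightPred ++ repeatWord (vertexAt p).leftPred n⟩ := by
  induction n with
  | zero => simp [repeatWord]
  | succ n ih =>
    rw [List.replicate_succ', ← List.append_assoc]
    have h (q : List Dir) : vertexAt (q ++ [Dir.left]) = (vertexAt q).child Dir.left := by
      simp [vertexAt]
    rw [h, ih]
    simp [Vertex.child, Vertex.period, repeatWord, List.replicate_succ']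

lemma vertexAt_append_right (p : List Dir) (n : ℕ) :
    vertexAt (p ++ List.replicate n Dir.right) =
      ⟨repeatWord (vertexAt p).rightPred n ++ (vertexAt p).leftPred, (vertexAt p).rightPred⟩ := by
  induction n with
  | zero => simp [repeatWord]
  | succ n ih =>
    rw [List.replicate_succ', ← List.append_assoc]
    have h (q : List Dir) : vertexAt (q ++ [Dir.right]) = (vertexAt q).child Dir.right := by
      simp [vertexAt]
    rw [h, ih]
    simp [Vertex.child, Vertex.period, repeatWord, List.replicate_succ]

lemma wordMat_repeatWord {l : List ℕ} {g : SL(2, ℤ)}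
    (e : (g : Matrix (Fin 2) (Fin 2) ℤ) = wordMat l) (n : ℕ) :
    ((g ^ n : SL(2, ℤ)) : Matrix (Fin 2) (Fin 2) ℤ) = wordMat (repeatWord l n) := by
  induction n with
  | zero => simp [repeatWord, wordMat]
  | succ n ih =>
    rw [pow_succ']
    change g.1 * (g ^ n).1 = wordMat (repeatWord l (n + 1))
    rw [repeatWord_succ, wordMat_append, ← e, ← ih]

lemma IsPos.pow_succ {g : SL(2, ℤ)} (hg : IsPos g) (n : ℕ) : IsPos (g ^ (n + 1)) := by
  rw [pow_succ']
  exact hg.mul_pow hg n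

lemma IsWord.repeatWord {l : List ℕ} (hl : IsWord l) (n : ℕ) :
    IsWord (repeatWord l (n + 1)) := by
  induction n with
  | zero => simpa [MarkovCycle.repeatWord] using hl
  | succ n ih =>
    rw [repeatWord_succ]
    exact hl.append ih

theorem tendsto_norValue_quadratic {f : ℍ → ℂ} (hc : Continuous f)
    (hi : ∀ (g : SL(2, ℤ)) (z : ℍ), f (g • z) = f z) (B : Branch) :
    Tendsto (fun n : ℕ => norValue f (B.quadratic n)) atTop (𝓝 (norValue f (B.quadratic 0))) := by
  obtain ⟨hx, hy⟩ := isWord_vertexAt B.tip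
  obtain ⟨g, hg, eg⟩ := hx.exists_isPos
  obtain ⟨h, hh, eh⟩ := hy.exists_isPos
  rw [← tendsto_add_atTop_iff_nat 1]
  rcases B with ⟨d, p, hp⟩
  cases d
  · have h0 : Branch.quadratic ⟨Dir.left, p, hp⟩ 0 = fixPt g := hx.periodicCF_eq hg eg
    have hn (n : ℕ) : Branch.quadratic ⟨Dir.left, p, hp⟩ (n + 1) = fixPt (h * g ^ (n + 1)) := by
      have e : (vertexAt (p ++ List.replicate n Dir.left)).period =
          (vertexAt p).rightPred ++ repeatWord (vertexAt p).leftPred (n + 1) := by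
        rw [vertexAt_append_left]
        simp [Vertex.period, repeatWord, List.replicate_succ']
      rw [Branch.quadratic, e]
      refine (hy.append (hx.repeatWord n)).periodicCF_eq (hh.mul_pow hg _) ?_
      change h.1 * (g ^ (n + 1)).1 = _
      rw [wordMat_append, ← eh, ← wordMat_repeatWord eg]
    simp_rw [h0, hn]
    exact (tendsto_norValue hc hi hh hg).comp (tendsto_add_atTop_nat 1)
  · have h0 : Branch.quadratic ⟨Dir.right, p, hp⟩ 0 = fixPt h := hy.periodicCF_eq hh eh
    have hn (n : ℕ) : Branch.quadratic ⟨Dir.right, p, hp⟩ (n + 1) = fixPt (h ^ (n + 1) * g) := by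
      have e : (vertexAt (p ++ List.replicate n Dir.right)).period =
          repeatWord (vertexAt p).rightPred (n + 1) ++ (vertexAt p).leftPred := by
        rw [vertexAt_append_right]
        simp [Vertex.period, repeatWord, List.replicate_succ]
      rw [Branch.quadratic, e]
      refine ((hy.repeatWord n).append hx).periodicCF_eq ((hh.pow_succ n).mul hg) ?_
      change (h ^ (n + 1)).1 * g.1 = _
      rw [wordMat_append, ← eg, ← wordMat_repeatWord eh]
    -- On a right branch the power stands on the left; conjugate products have the same closed
    -- geodesic, so the factors may be exchanged.
    simp_rw [h0, hn, norValue_fixPt_mul_comm hc hi (hh.pow_succ _) hg]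
    exact (tendsto_norValue hc hi hg hh).comp (tendsto_add_atTop_nat 1)

end MarkovCycle

end

theorem theorem1 (f : UpperHalfPlane → ℂ) (hf : MarkovCycle.IsModularFunction f)
    (B : MarkovCycle.Branch) :
    Filter.Tendsto (fun n : ℕ => MarkovCycle.norValue f (B.quadratic n)) Filter.atTop
      (nhds (MarkovCycle.norValue f (B.quadratic 0))) :=
  MarkovCycle.tendsto_norValue_quadratic hf.holo.continuous hf.invariant B
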